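/- Let $d\ge 2$ be an even integer and let $G$ be the pro-$3$ group with generators $x_1,\dots,x_d$ and the single defining relation $$x_1^3[x_1,x_2][x_3,x_4]\cdots[x_{d-1},x_d]=1,\qquad [x,y]=x^{-1}y^{-1}xy .$$ Let $C^\bullet=C^\bullet(G,\mathbb F_3)$ be the differential graded algebra of continuous inhomogeneous cochains of $G$ with values in the discrete trivial $G$-module $\mathbb F_3$, with its usual differential $\delta$ and cup product, and let $H^\bullet=H^\bullet(G,\mathbb F_3)$ be its cohomology algebra. Then: 1. the canonical class of $C^\bullet(G,\mathbb F_3)$ in the Hochschild cohomology group $HH^{3,-1}(H^\bullet(G,\mathbb F_3))$ is nonzero; and 2. $C^\bullet(G,\mathbb F_3)$ is not $A_3$-formal. The notions used here are the following. *Hochschild cohomology.* For a graded algebra $A$ over a field, $C^{n,s}(A)$ is the space of graded linear maps $\varphi\colon A^{\otimes n}\to A$ raising the degree by $s$, with differential $C^{n,s}(A)\to C^{n+1,s}(A)$ $$(\partial\varphi)(a_1,\dots,a_{n+1})=(-1)^{s|a_1|}a_1\varphi(a_2,\dots,a_{n+1})+\sum_{j=1}^{n}(-1)^j\varphi(\dots,a_ja_{j+1},\dots)+(-1)^{n+1}\varphi(a_1,\dots,a_n)a_{n+1},$$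 and $HH^{n,s}(A)$ is its cohomology at $C^{n,s}(A)$. *Canonical class.* For a differential graded algebra $(C^\bullet,\delta)$ over a field with cohomology algebra $H^\bullet$, choose a graded linear map $f_1$ from $H^\bullet$ to the cocycles of $C^\bullet$ that sends each class to a representative of it, and a bilinear map $f_2\colon H^i\times H^j\to C^{i+j-1}$ with $\delta f_2(x,y)=f_1(xy)-f_1(x)f_1(y)$. Then $$\Phi_3(x,y,z)=(-1)^{|x|}f_1(x)f_2(y,z)-f_2(x,y)f_1(z)-f_2(xy,z)+f_2(x,yz)$$ is a cocycle in $C^\bullet$. The map $m_3(x,y,z)=[\Phi_3(x,y,z)]$ is a Hochschild cocycle in $C^{3,-1}(H^\bullet)$, and its class in $HH^{3,-1}(H^\bullet)$, which does not depend on the choices of $f_1$ and $f_2$, is the canonical class. *$A_3$-formality.* In the following, a tensor product of graded maps is evaluated with the Koszul sign rule. An $A_3$-algebra is a graded vector space $V^\bullet$ with $V^i=0$ for $i<0$ and $V^0$ one-dimensional, together with linear maps $m_n\colon V^{\otimes n}\to V$ of degree $2-n$ for $n=1,2,3$, such that $m_1m_1=0$, $m_1m_2=m_2(m_1\otimes1+1\otimes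 m_1)$ and $$m_2(1\otimes m_2-m_2\otimes 1)=m_1m_3+m_3(m_1\otimes1\otimes1+1\otimes m_1\otimes1+1\otimes1\otimes m_1).$$ It is minimal if $m_1=0$. A differential graded algebra $C^\bullet$ with $C^i=0$ for $i<0$ and $C^0$ equal to the ground field is an $A_3$-algebra with $m_1=\delta$, $m_2$ the product and $m_3=0$. A morphism of $A_3$-algebras $V\to W$ is given by linear maps $f_n\colon V^{\otimes n}\to W$ of degree $1-n$ for $n=1,2,3$ with $f_1m_1=m_1f_1$, $$f_1m_2-m_2(f_1\otimes f_1)=m_1f_2+f_2(m_1\otimes1+1\otimes m_1),$$ $$m_1f_3+m_2(f_1\otimes f_2-f_2\otimes f_1)+m_3(f_1\otimes f_1\otimes f_1)=f_1m_3+f_2(m_2\otimes1-1\otimes m_2)+f_3(m_1\otimes1\otimes1+1\otimes m_1\otimes1+1\otimes1\otimes m_1),$$ and it is a quasi-isomorphism if $f_1$ induces an isomorphism on cohomology. The algebra $C^\bullet$ is $A_3$-formal if there are a minimal $A_3$-algebra $M$ with $m_3=0$ and a quasi-isomorphism of $A_3$-algebras $M\to C^\bullet$. -/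

import Mathlib

open scoped DirectSum

noncomputable section

namespace A3F

universe u v w

/-! ### Graded vector spaces, sign twists -/

section Graded

variable {F : Type u} [Field F] {V : Type v} [AddCommGroup V] [Module F V]
  (𝒱 : ℤ → Submodule F V) [DirectSum.Decomposition 𝒱]

/-- The linear endomorphism of a graded vector space that multiplies a homogeneous element of
degree `i` by the sign `(-1) ^ (s * i)`. -/
def signTwist (s : ℤ) : V →ₗ[F] V :=
  DirectSum.toModule F ℤ V (fun i => (-1 : F) ^ (s * i) • (𝒱 i).subtype) ∘ₗ
    (DirectSum.decomposeLinearEquiv 𝒱).toLinearMap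

theorem signTwist_of_mem (s : ℤ) {i : ℤ} {a : V} (ha : a ∈ 𝒱 i) :
    signTwist 𝒱 s a = (-1 : F) ^ (s * i) • a := by
  rw [signTwist, LinearMap.comp_apply, LinearEquiv.coe_coe, DirectSum.decomposeLinearEquiv_apply,
    DirectSum.decompose_of_mem 𝒱 ha, ← DirectSum.lof_eq_of F, DirectSum.toModule_lof]
  rfl

/-- Linear maps agreeing on homogeneous elements are equal. -/
theorem graded_ext {W : Type w} [AddCommGroup W] [Module F W] {f g : V →ₗ[F] W}
    (h : ∀ i, ∀ a ∈ 𝒱 i, f a = g a) (x : V) : f x = g x := by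
  induction x using DirectSum.Decomposition.inductionOn 𝒱 with
  | zero => simp
  | homogeneous a => exact h _ _ a.2
  | add a b ha hb => rw [map_add, map_add, ha, hb]

/-- Surjective linear maps of vector spaces have linear sections. -/
theorem exists_linear_section {W : Type w} [AddCommGroup W] [Module F W] (f : V →ₗ[F] W)
    (hf : Function.Surjective f) : ∃ g : W →ₗ[F] V, ∀ x, f (g x) = x := by
  obtain ⟨g, hg⟩ := f.exists_rightInverse_of_surjective (LinearMap.range_eq_top.2 hf)
  exact ⟨g, fun x => LinearMap.congr_fun hg x⟩

/-- Linear maps of vector spaces have generalized inverses. -/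
theorem exists_linear_geninv {W : Type w} [AddCommGroup W] [Module F W] (f : V →ₗ[F] W) :
    ∃ g : W →ₗ[F] V, ∀ x, f (g (f x)) = f x := by
  obtain ⟨S, hS⟩ := exists_linear_section f.rangeRestrict (LinearMap.surjective_rangeRestrict f)
  obtain ⟨T, hT⟩ := LinearMap.exists_extend S
  refine ⟨T, fun x => ?_⟩
  have h1 : T (f x) = S ⟨f x, x, rfl⟩ := LinearMap.congr_fun hT ⟨f x, x, rfl⟩
  rw [h1]
  exact congrArg Subtype.val (hS ⟨f x, x, rfl⟩)

/-- Linear maps given on the homogeneous components assemble to a linear map. -/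
def assemble {W : Type w} [AddCommGroup W] [Module F W] (f : ∀ i, 𝒱 i →ₗ[F] W) : V →ₗ[F] W :=
  DirectSum.toModule F ℤ W f ∘ₗ (DirectSum.decomposeLinearEquiv 𝒱).toLinearMap

theorem assemble_of_mem {W : Type w} [AddCommGroup W] [Module F W] (f : ∀ i, 𝒱 i →ₗ[F] W)
    {i : ℤ} {a : V} (ha : a ∈ 𝒱 i) : assemble 𝒱 f a = f i ⟨a, ha⟩ := by
  rw [assemble, LinearMap.comp_apply, LinearEquiv.coe_coe, DirectSum.decomposeLinearEquiv_apply,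
    DirectSum.decompose_of_mem 𝒱 ha, ← DirectSum.lof_eq_of F, DirectSum.toModule_lof]

end Graded

/-! ### Graded Hochschild cohomology -/

section Hochschild

variable {F : Type u} [Field F] {A : Type v} [Ring A] [Algebra F A]
  (𝒜 : ℤ → Submodule F A) [GradedAlgebra 𝒜]

theorem contractNth_update (n : ℕ) (j : Fin n) (a : Fin (n + 1) → A) (t : Fin (n + 1)) :
    ∃ (r : Fin n) (b c : A), ∀ x : A,
      Fin.contractNth j.castSucc (· * ·) (Function.update a t x) =
        Function.update (Fin.contractNth j.castSucc (· * ·) a) r (b * x * c) := by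
  have key : ∀ (r : Fin n) (b c : A), (∀ (x : A) (k : Fin n),
      Fin.contractNth j.castSucc (· * ·) (Function.update a t x) k =
        if k = r then b * x * c else Fin.contractNth j.castSucc (· * ·) a k) →
      ∃ (r : Fin n) (b c : A), ∀ x : A,
      Fin.contractNth j.castSucc (· * ·) (Function.update a t x) =
        Function.update (Fin.contractNth j.castSucc (· * ·) a) r (b * x * c) := by
    intro r b c h
    refine ⟨r, b, c, fun x => ?_⟩
    ext k
    rw [h, Function.update_apply]
  rcases lt_trichotomy t.val j.val with h | h | h
  · refine key ⟨t, by omega⟩ 1 1 fun x k => ?_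
    simp only [Fin.contractNth, Function.update_apply, Fin.ext_iff, Fin.val_castSucc, Fin.val_succ]
    split_ifs <;> first | omega | simp
  · refine key j 1 (a j.succ) fun x k => ?_
    simp only [Fin.contractNth, Function.update_apply, Fin.ext_iff, Fin.val_castSucc, Fin.val_succ]
    split_ifs with h1 h2 h3 h4 h5 <;> first | omega | (simp; try (congr 2; ext; simp; omega))
  · by_cases h' : t.val = j.val + 1
    · refine key j (a j.castSucc) 1 fun x k => ?_
      simp only [Fin.contractNth, Function.update_apply, Fin.ext_iff, Fin.val_castSucc,
        Fin.val_succ]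
      split_ifs with h1 h2 h3 h4 h5 <;> first | omega | (simp; try (congr 2; ext; simp; omega))
    · refine key ⟨t.val - 1, by omega⟩ 1 1 fun x k => ?_
      simp only [Fin.contractNth, Function.update_apply, Fin.ext_iff, Fin.val_castSucc,
        Fin.val_succ]
      split_ifs <;> first | omega | simp

/-- The inner term `f (a₁, …, aⱼ aⱼ₊₁, …, aₙ₊₁)` of the Hochschild differential. -/
def innerTerm {n : ℕ} (j : Fin n) (f : MultilinearMap F (fun _ : Fin n => A) A) :
    MultilinearMap F (fun _ : Fin (n + 1) => A) A :=
  MultilinearMap.mk' (fun a => f (Fin.contractNth j.castSucc (· * ·) a))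
    (fun a t x y => by
      obtain ⟨r, b, c, h⟩ := contractNth_update n j a t
      rw [h, h, h, mul_add, add_mul, f.map_update_add])
    (fun a t s x => by
      obtain ⟨r, b, c, h⟩ := contractNth_update n j a t
      rw [h, h, mul_smul_comm, smul_mul_assoc, f.map_update_smul])

/-- The first term `(-1) ^ (s |a₁|) a₁ f (a₂, …, aₙ₊₁)` of the Hochschild differential. -/
def firstTerm (s : ℤ) {n : ℕ} (f : MultilinearMap F (fun _ : Fin n => A) A) :
    MultilinearMap F (fun _ : Fin (n + 1) => A) A :=
  MultilinearMap.mk' (fun a => signTwist 𝒜 s (a 0) * f (Fin.tail a))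
    (fun a t x y => by
      rcases Fin.eq_zero_or_eq_succ t with rfl | ⟨t, rfl⟩
      · simp [add_mul]
      · simp [Fin.tail_update_succ, mul_add, (Fin.succ_ne_zero t).symm])
    (fun a t r x => by
      rcases Fin.eq_zero_or_eq_succ t with rfl | ⟨t, rfl⟩
      · simp
      · simp [Fin.tail_update_succ, (Fin.succ_ne_zero t).symm])

/-- The last term `f (a₁, …, aₙ) aₙ₊₁` of the Hochschild differential. -/
def lastTerm {n : ℕ} (f : MultilinearMap F (fun _ : Fin n => A) A) :
    MultilinearMap F (fun _ : Fin (n + 1) => A) A :=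
  MultilinearMap.mk' (fun a => f (Fin.init a) * a (Fin.last n))
    (fun a t x y => by
      rcases Fin.eq_castSucc_or_eq_last t with ⟨t, rfl⟩ | rfl
      · simp [Fin.init_update_castSucc, add_mul, (Fin.castSucc_ne_last t).symm]
      · simp [mul_add])
    (fun a t r x => by
      rcases Fin.eq_castSucc_or_eq_last t with ⟨t, rfl⟩ | rfl
      · simp [Fin.init_update_castSucc, (Fin.castSucc_ne_last t).symm]
      · simp)

/-- The graded Hochschild differential
`(∂ f)(a₁, …, aₙ₊₁) = (-1) ^ (s |a₁|) a₁ f(a₂, …, aₙ₊₁) + ∑ⱼ (-1) ^ j f(a₁, …, aⱼ aⱼ₊₁, …, aₙ₊₁)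
  + (-1) ^ (n + 1) f(a₁, …, aₙ) aₙ₊₁` on multilinear functions, for the internal degree `s`. -/
def hochschildDifferential (s : ℤ) (n : ℕ) :
    MultilinearMap F (fun _ : Fin n => A) A →ₗ[F]
      MultilinearMap F (fun _ : Fin (n + 1) => A) A where
  toFun f := firstTerm 𝒜 s f + ∑ j : Fin n, (-1 : F) ^ (j.val + 1) • innerTerm j f +
    (-1 : F) ^ (n + 1) • lastTerm f
  map_add' f g := by
    ext a
    simp [firstTerm, innerTerm, lastTerm, mul_add, add_mul, Finset.sum_add_distrib]
    abel
  map_smul' r f := by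
    ext a
    simp [firstTerm, innerTerm, lastTerm, smul_add, Finset.smul_sum, smul_comm r]

theorem hochschildDifferential_apply (s : ℤ) (n : ℕ)
    (f : MultilinearMap F (fun _ : Fin n => A) A) (a : Fin (n + 1) → A) :
    hochschildDifferential 𝒜 s n f a = signTwist 𝒜 s (a 0) * f (Fin.tail a) +
      ∑ j : Fin n, (-1 : F) ^ (j.val + 1) • f (Fin.contractNth j.castSucc (· * ·) a) +
      (-1 : F) ^ (n + 1) • (f (Fin.init a) * a (Fin.last n)) := by
  simp [hochschildDifferential, firstTerm, innerTerm, lastTerm]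

theorem hochschildDifferential_two (s : ℤ) (f : MultilinearMap F (fun _ : Fin 2 => A) A)
    (x y z : A) : hochschildDifferential 𝒜 s 2 f ![x, y, z] =
      signTwist 𝒜 s x * f ![y, z] - f ![x * y, z] + f ![x, y * z] - f ![x, y] * z := by
  have e0 : Fin.contractNth (Fin.castSucc (0 : Fin 2)) (· * ·) ![x, y, z] = ![x * y, z] := by
    ext i; fin_cases i <;> simp [Fin.contractNth]
  have e1 : Fin.contractNth (Fin.castSucc (1 : Fin 2)) (· * ·) ![x, y, z] = ![x, y * z] := by
    ext i; fin_cases i <;> simp [Fin.contractNth]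
  have e2 : Fin.init ![x, y, z] = ![x, y] := by
    ext i; fin_cases i <;> simp [Fin.init]
  have e3 : Fin.tail ![x, y, z] = ![y, z] := by
    ext i; fin_cases i <;> simp [Fin.tail]
  have e4 : ![x, y, z] (Fin.last 2) = z := rfl
  rw [hochschildDifferential_apply, Fin.sum_univ_two, e0, e1, e2, e3, e4]
  simp [pow_succ]
  noncomm_ring

theorem hochschildDifferential_three (s : ℤ) (f : MultilinearMap F (fun _ : Fin 3 => A) A)
    (w x y z : A) : hochschildDifferential 𝒜 s 3 f ![w, x, y, z] =
      signTwist 𝒜 s w * f ![x, y, z] - f ![w * x, y, z] + f ![w, x * y, z] - f ![w, x, y * z] +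
        f ![w, x, y] * z := by
  have e0 : Fin.contractNth (Fin.castSucc (0 : Fin 3)) (· * ·) ![w, x, y, z] =
      ![w * x, y, z] := by
    ext i; fin_cases i <;> simp [Fin.contractNth]
  have e1 : Fin.contractNth (Fin.castSucc (1 : Fin 3)) (· * ·) ![w, x, y, z] =
      ![w, x * y, z] := by
    ext i; fin_cases i <;> simp [Fin.contractNth]
  have e5 : Fin.contractNth (Fin.castSucc (2 : Fin 3)) (· * ·) ![w, x, y, z] =
      ![w, x, y * z] := by
    ext i; fin_cases i <;> simp [Fin.contractNth]
  have e2 : Fin.init ![w, x, y, z] = ![w, x, y] := by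
    ext i; fin_cases i <;> simp [Fin.init]
  have e3 : Fin.tail ![w, x, y, z] = ![x, y, z] := by
    ext i; fin_cases i <;> simp [Fin.tail]
  have e4 : ![w, x, y, z] (Fin.last 3) = z := rfl
  rw [hochschildDifferential_apply, Fin.sum_univ_three, e0, e1, e2, e3, e4, e5]
  simp [pow_succ]
  noncomm_ring

/-- The Hochschild cochains `C^{n,s}(A, A)`: the multilinear functions of `n` elements of `A`
which raise the degree by `s`, i.e. the graded linear maps `A^{⊗ n} → A[s]`. -/
def hochschildCochains (n : ℕ) (s : ℤ) :
    Submodule F (MultilinearMap F (fun _ : Fin n => A) A) where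
  carrier := {f | ∀ (i : Fin n → ℤ) (a : Fin n → A), (∀ t, a t ∈ 𝒜 (i t)) →
    f a ∈ 𝒜 (∑ t, i t + s)}
  add_mem' hf hg i a h := add_mem (hf i a h) (hg i a h)
  zero_mem' _ _ _ := zero_mem _
  smul_mem' r _ hf i a h := Submodule.smul_mem _ r (hf i a h)

/-- The Hochschild cocycles in `C^{n,s}(A, A)`. -/
def hochschildCocycles (n : ℕ) (s : ℤ) : Submodule F (MultilinearMap F (fun _ : Fin n => A) A) :=
  hochschildCochains 𝒜 n s ⊓ LinearMap.ker (hochschildDifferential 𝒜 s n)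

/-- The Hochschild coboundaries in `C^{n,s}(A, A)`: the image of `C^{n-1,s}(A, A)`. -/
def hochschildCoboundaries :
    ∀ n : ℕ, ℤ → Submodule F (MultilinearMap F (fun _ : Fin n => A) A)
  | 0, _ => ⊥
  | n + 1, s => (hochschildCochains 𝒜 n s).map (hochschildDifferential 𝒜 s n)

/- The usual additive group of multilinear functions, presented so that quotients of submodules
are found by instance search. -/
instance (priority := 2000) multilinearAddCommGroup (n : ℕ) :
    AddCommGroup (MultilinearMap F (fun _ : Fin n => A) A) :=
  { MultilinearMap.instAddCommGroup with toAddCommMonoid := MultilinearMap.addCommMonoid }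

/-- The graded Hochschild cohomology `HH^{n,s}(A) = HH^{n,s}(A, A)`: cocycles modulo
(those which are) coboundaries. -/
abbrev HH (n : ℕ) (s : ℤ) : Type v :=
  hochschildCocycles 𝒜 n s ⧸
    (hochschildCoboundaries 𝒜 n s).comap (hochschildCocycles 𝒜 n s).subtype

end Hochschild

/-- A family of submodules with compatible projections that spans is an internal direct sum. -/
theorem isInternal_of_proj {F : Type u} [Field F] {V : Type v} [AddCommGroup V] [Module F V]
    (𝒱 : ℤ → Submodule F V) (π : ℤ → V →ₗ[F] V) (h1 : ∀ i, ∀ x ∈ 𝒱 i, π i x = x)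
    (h2 : ∀ i j, i ≠ j → ∀ x ∈ 𝒱 j, π i x = 0) (h3 : ⨆ i, 𝒱 i = ⊤) :
    DirectSum.IsInternal 𝒱 := by
  have key : ∀ (x : ⨁ i, 𝒱 i) (i : ℤ), π i (DirectSum.coeAddMonoidHom 𝒱 x) = x i := by
    intro x i
    induction x using DirectSum.induction_on with
    | zero => simp
    | of j x =>
      rw [DirectSum.coeAddMonoidHom_of]
      by_cases hij : i = j
      · subst hij
        rw [h1 i _ x.2, DirectSum.of_eq_same]
      · rw [h2 i j hij _ x.2, DirectSum.of_eq_of_ne _ _ _ hij]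
        rfl
    | add x y hx hy => rw [map_add, map_add, hx, hy]; rfl
  refine ⟨?_, ?_⟩
  · rw [injective_iff_map_eq_zero]
    intro x hx
    ext i
    have := key x i
    rw [hx, map_zero] at this
    rw [← this]; rfl
  · intro x
    have hx : x ∈ ⨆ i, 𝒱 i := by rw [h3]; trivial
    induction hx using Submodule.iSup_induction' with
    | mem i x hx => exact ⟨DirectSum.of _ i ⟨x, hx⟩, by simp⟩
    | zero => exact ⟨0, by simp⟩
    | add x y _ _ hx hy =>
      obtain ⟨a, rfl⟩ := hx
      obtain ⟨b, rfl⟩ := hy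
      exact ⟨a + b, by simp⟩

/-! ### Differential graded algebras -/

/-- A (cohomologically and `ℤ`-)graded differential algebra over a field. -/
structure DGAlgebra (F : Type u) [Field F] where
  /-- the underlying algebra, i.e. the direct sum of all homogeneous parts -/
  carrier : Type v
  [ring : Ring carrier]
  [algebra : Algebra F carrier]
  /-- the homogeneous parts -/
  gr : ℤ → Submodule F carrier
  [graded : GradedAlgebra gr]
  /-- the differential -/
  d : carrier →ₗ[F] carrier
  d_mem : ∀ (i : ℤ) (a : carrier), a ∈ gr i → d a ∈ gr (i + 1)
  d_d : ∀ a, d (d a) = 0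
  leibniz : ∀ (i : ℤ) (a b : carrier), a ∈ gr i →
    d (a * b) = d a * b + (-1 : F) ^ i • (a * d b)

namespace DGAlgebra

attribute [instance] DGAlgebra.ring DGAlgebra.algebra DGAlgebra.graded

variable {F : Type u} [Field F] (A : DGAlgebra.{u, v} F)

/-- A differential graded algebra is connected if `Aⁱ = 0` for `i < 0` and `A⁰ = F`. -/
def IsConnected : Prop :=
  (∀ i < 0, A.gr i = ⊥) ∧ Function.Injective (algebraMap F A.carrier) ∧ A.gr 0 = 1

/-- The sign involution `a ↦ (-1) ^ |a| a`. -/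
def inv : A.carrier →ₗ[F] A.carrier := signTwist A.gr 1

theorem inv_of_mem {i : ℤ} {a : A.carrier} (ha : a ∈ A.gr i) : A.inv a = (-1 : F) ^ i • a := by
  rw [inv, signTwist_of_mem A.gr 1 ha, one_mul]

theorem inv_inv (a : A.carrier) : A.inv (A.inv a) = a := by
  refine graded_ext A.gr (f := A.inv ∘ₗ A.inv) (g := LinearMap.id) (fun i a ha => ?_) a
  simp only [LinearMap.comp_apply, LinearMap.id_apply]
  rw [A.inv_of_mem ha, map_smul, A.inv_of_mem ha, smul_smul, ← mul_zpow]
  simp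

theorem inv_mul (a b : A.carrier) : A.inv (a * b) = A.inv a * A.inv b := by
  refine graded_ext A.gr (f := A.inv ∘ₗ LinearMap.mulRight F b)
    (g := LinearMap.mulRight F (A.inv b) ∘ₗ A.inv) (fun i a ha => ?_) a
  refine graded_ext A.gr (f := A.inv ∘ₗ LinearMap.mulLeft F a)
    (g := LinearMap.mulLeft F (A.inv a) ∘ₗ A.inv) (fun j b hb => ?_) b
  simp only [LinearMap.comp_apply, LinearMap.mulLeft_apply]
  rw [A.inv_of_mem ha, A.inv_of_mem hb, A.inv_of_mem (SetLike.mul_mem_graded ha hb),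
    zpow_add₀ (by simp), smul_mul_smul_comm]

theorem d_inv (a : A.carrier) : A.d (A.inv a) = - A.inv (A.d a) := by
  refine graded_ext A.gr (f := A.d ∘ₗ A.inv) (g := -(A.inv ∘ₗ A.d)) (fun i a ha => ?_) a
  simp only [LinearMap.comp_apply, LinearMap.neg_apply]
  rw [A.inv_of_mem ha, A.inv_of_mem (A.d_mem i a ha), map_smul, zpow_add₀ (by simp)]
  simp

theorem d_mul (a b : A.carrier) : A.d (a * b) = A.d a * b + A.inv a * A.d b := by
  refine graded_ext A.gr (f := A.d ∘ₗ LinearMap.mulRight F b)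
    (g := LinearMap.mulRight F b ∘ₗ A.d + LinearMap.mulRight F (A.d b) ∘ₗ A.inv)
    (fun i a ha => ?_) a
  simp only [LinearMap.comp_apply, LinearMap.add_apply, LinearMap.mulRight_apply]
  rw [A.leibniz i a b ha, A.inv_of_mem ha, smul_mul_assoc]

theorem d_one : A.d 1 = 0 := by
  have h := A.leibniz 0 1 1 (SetLike.one_mem_graded A.gr)
  simpa using h

theorem d_algebraMap (r : F) : A.d (algebraMap F A.carrier r) = 0 := by
  rw [Algebra.algebraMap_eq_smul_one, map_smul, d_one, smul_zero]

/-- The subalgebra of cocycles. -/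
def cocycles : Subalgebra F A.carrier where
  carrier := {a | A.d a = 0}
  mul_mem' {a b} ha hb := by
    simp only [Set.mem_ofPred_eq] at *
    rw [d_mul, ha, hb, zero_mul, mul_zero, add_zero]
  add_mem' {a b} ha hb := by
    simp only [Set.mem_ofPred_eq] at *
    rw [map_add, ha, hb, add_zero]
  algebraMap_mem' r := A.d_algebraMap r

theorem mem_cocycles {a : A.carrier} : a ∈ A.cocycles ↔ A.d a = 0 := Iff.rfl

/-- The ideal of coboundaries in the algebra of cocycles. -/
def coboundaries : Ideal A.cocycles where
  carrier := {a | ∃ c, A.d c = (a : A.carrier)}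
  add_mem' := by
    rintro a b ⟨c, hc⟩ ⟨e, he⟩
    exact ⟨c + e, by simp [hc, he]⟩
  zero_mem' := ⟨0, by simp⟩
  smul_mem' := by
    rintro z a ⟨c, hc⟩
    refine ⟨A.inv z * c, ?_⟩
    rw [d_mul, d_inv, A.mem_cocycles.1 z.2, inv_inv, hc]
    simp

theorem mem_coboundaries {a : A.cocycles} :
    a ∈ A.coboundaries ↔ ∃ c, A.d c = (a : A.carrier) := Iff.rfl

instance : A.coboundaries.IsTwoSided where
  mul_mem_of_left := by
    rintro a z ⟨c, hc⟩
    refine ⟨c * z, ?_⟩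
    rw [d_mul, hc, A.mem_cocycles.1 z.2]
    simp

/-- The cohomology algebra `H^•(A)`: cocycles modulo coboundaries. -/
abbrev Cohomology : Type v := A.cocycles ⧸ A.coboundaries

/-- The cohomology class of a cocycle. -/
def cls : A.cocycles →ₗ[F] A.Cohomology :=
  (Ideal.Quotient.mkₐ F A.coboundaries).toLinearMap

theorem cls_mul (a b : A.cocycles) : A.cls (a * b) = A.cls a * A.cls b :=
  map_mul (Ideal.Quotient.mkₐ F A.coboundaries) a b

theorem cls_surjective : Function.Surjective A.cls := Ideal.Quotient.mk_surjective

theorem cls_eq_zero {a : A.cocycles} : A.cls a = 0 ↔ ∃ c, A.d c = (a : A.carrier) :=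
  Ideal.Quotient.eq_zero_iff_mem

/-- The part `Hⁱ(A)` of the cohomology algebra: classes of homogeneous cocycles of degree `i`. -/
def cohomologyGr (i : ℤ) : Submodule F A.Cohomology :=
  ((A.gr i).comap A.cocycles.val.toLinearMap).map A.cls

theorem mem_cohomologyGr {i : ℤ} {x : A.Cohomology} :
    x ∈ A.cohomologyGr i ↔ ∃ a : A.cocycles, (a : A.carrier) ∈ A.gr i ∧ A.cls a = x := Iff.rfl

theorem d_proj (i : ℤ) (a : A.carrier) :
    A.d (GradedAlgebra.proj A.gr i a) = GradedAlgebra.proj A.gr (i + 1) (A.d a) := by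
  refine graded_ext A.gr (f := A.d ∘ₗ GradedAlgebra.proj A.gr i)
    (g := GradedAlgebra.proj A.gr (i + 1) ∘ₗ A.d) (fun j a ha => ?_) a
  simp only [LinearMap.comp_apply, GradedAlgebra.proj_apply]
  by_cases h : j = i
  · subst h
    rw [DirectSum.decompose_of_mem_same _ ha, DirectSum.decompose_of_mem_same _ (A.d_mem _ _ ha)]
  · rw [DirectSum.decompose_of_mem_ne _ ha h, map_zero,
      DirectSum.decompose_of_mem_ne _ (A.d_mem _ _ ha) (by omega)]

/-- The projection of the cohomology to its degree `i` part. -/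
def cohomologyProj (i : ℤ) : A.Cohomology →ₗ[F] A.Cohomology :=
  (Submodule.liftQ (A.coboundaries.restrictScalars F)
    (A.cls ∘ₗ (GradedAlgebra.proj A.gr i).restrict (p := A.cocycles.toSubmodule)
      (q := A.cocycles.toSubmodule) (fun a ha => by
        have ha' : A.d a = 0 := ha
        change A.d _ = 0
        rw [d_proj, ha', map_zero])) (by
      rintro a ⟨c, hc⟩
      have hc' : A.d (GradedAlgebra.proj A.gr (i - 1) c) =
          GradedAlgebra.proj A.gr i (a : A.carrier) := by
        rw [d_proj, hc, sub_add_cancel]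
      exact A.cls_eq_zero.2 ⟨_, hc'⟩)) ∘ₗ
    (Submodule.Quotient.restrictScalarsEquiv F A.coboundaries).symm.toLinearMap

theorem cohomologyProj_cls (i : ℤ) (a : A.cocycles) :
    ∃ h, A.cohomologyProj i (A.cls a) = A.cls ⟨GradedAlgebra.proj A.gr i a, h⟩ :=
  ⟨_, rfl⟩

theorem iSup_cohomologyGr : ⨆ i, A.cohomologyGr i = ⊤ := by
  classical
  rw [eq_top_iff]
  rintro x -
  obtain ⟨a, rfl⟩ := A.cls_surjective x
  have h : ∀ i, A.d (GradedAlgebra.proj A.gr i a) = 0 := fun i => by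
    rw [d_proj, A.mem_cocycles.1 a.2, map_zero]
  have ha : a = ∑ i ∈ (DirectSum.decompose A.gr (a : A.carrier)).support,
      (⟨GradedAlgebra.proj A.gr i a, h i⟩ : A.cocycles) := by
    apply Subtype.ext
    rw [AddSubmonoidClass.coe_finsetSum]
    exact (DirectSum.sum_support_decompose A.gr (a : A.carrier)).symm
  rw [ha, map_sum]
  refine Submodule.sum_mem _ fun i _ => Submodule.mem_iSup_of_mem i ?_
  refine ⟨_, ?_, rfl⟩
  exact (DirectSum.decompose A.gr (a : A.carrier) i).2

theorem isInternal_cohomologyGr : DirectSum.IsInternal A.cohomologyGr := by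
  refine isInternal_of_proj _ A.cohomologyProj ?_ ?_ A.iSup_cohomologyGr
  · rintro i x ⟨a, ha, rfl⟩
    obtain ⟨h, e⟩ := A.cohomologyProj_cls i a
    rw [e]
    congr 1
    apply Subtype.ext
    exact DirectSum.decompose_of_mem_same _ ha
  · rintro i j hij x ⟨a, ha, rfl⟩
    obtain ⟨h, e⟩ := A.cohomologyProj_cls i a
    rw [e, ← map_zero A.cls]
    congr 1
    apply Subtype.ext
    exact DirectSum.decompose_of_mem_ne _ ha hij.symm

instance : GradedAlgebra A.cohomologyGr :=
  { A.isInternal_cohomologyGr.chooseDecomposition with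
    one_mem := ⟨1, SetLike.one_mem_graded A.gr, map_one (Ideal.Quotient.mkₐ F A.coboundaries)⟩
    mul_mem := by
      rintro i j x y ⟨a, ha, rfl⟩ ⟨b, hb, rfl⟩
      have ha' : (a : A.carrier) ∈ A.gr i := ha
      have hb' : (b : A.carrier) ∈ A.gr j := hb
      exact ⟨a * b, SetLike.mul_mem_graded ha' hb', A.cls_mul a b⟩ }

theorem signTwist_cls (a : A.cocycles) :
    ∃ h : A.inv a ∈ A.cocycles, signTwist A.cohomologyGr (-1) (A.cls a) = A.cls ⟨A.inv a, h⟩ := by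
  have hc : ∀ a : A.cocycles, A.inv a ∈ A.cocycles := fun a => by
    rw [mem_cocycles, d_inv, A.mem_cocycles.1 a.2, map_zero, neg_zero]
  refine ⟨hc a, ?_⟩
  obtain ⟨T, hT⟩ : ∃ T : A.cocycles →ₗ[F] A.cocycles, ∀ a, T a = ⟨A.inv a, hc a⟩ :=
    ⟨A.inv.restrict (p := A.cocycles.toSubmodule) (q := A.cocycles.toSubmodule)
      (fun a ha => hc ⟨a, ha⟩), fun a => rfl⟩
  rw [← hT]
  have hp : ∀ i, A.d (GradedAlgebra.proj A.gr i a) = 0 := fun i => by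
    rw [d_proj, A.mem_cocycles.1 a.2, map_zero]
  classical
  have ha : a = ∑ i ∈ (DirectSum.decompose A.gr (a : A.carrier)).support,
      (⟨GradedAlgebra.proj A.gr i a, hp i⟩ : A.cocycles) := by
    apply Subtype.ext
    rw [AddSubmonoidClass.coe_finsetSum]
    exact (DirectSum.sum_support_decompose A.gr (a : A.carrier)).symm
  rw [ha, map_sum, map_sum, map_sum, map_sum]
  refine Finset.sum_congr rfl fun i _ => ?_
  have hm : GradedAlgebra.proj A.gr i a ∈ A.gr i :=
    (DirectSum.decompose A.gr (a : A.carrier) i).2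
  rw [signTwist_of_mem A.cohomologyGr (-1) (i := i) ⟨_, hm, rfl⟩, hT, ← map_smul]
  congr 1
  apply Subtype.ext
  simp only [A.inv_of_mem hm, neg_mul, one_mul, zpow_neg, ← inv_zpow, inv_neg, inv_one]
  rfl

end DGAlgebra

namespace DGAlgebra
variable {F : Type u} [Field F] (A : DGAlgebra.{u, v} F)

/-! ### The canonical class -/

/-- A pair `(f₁, f₂)` of graded linear maps, where `f₁ : H^•(A) → ker d` has degree `0` and induces
the identity on cohomology, and `f₂ : H^•(A) ⊗ H^•(A) → A` has degree `-1` and satisfies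
`d f₂ = f₁ m₂ - m₂ (f₁ ⊗ f₁)`. -/
structure LiftPair where
  f₁ : A.Cohomology →ₗ[F] A.cocycles
  f₁_mem : ∀ (i : ℤ) (x : A.Cohomology), x ∈ A.cohomologyGr i → (f₁ x : A.carrier) ∈ A.gr i
  cls_f₁ : ∀ x, A.cls (f₁ x) = x
  f₂ : A.Cohomology →ₗ[F] A.Cohomology →ₗ[F] A.carrier
  f₂_mem : ∀ (i j : ℤ) (x y : A.Cohomology), x ∈ A.cohomologyGr i → y ∈ A.cohomologyGr j →
    f₂ x y ∈ A.gr (i + j - 1)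
  d_f₂ : ∀ x y, A.d (f₂ x y) = (f₁ (x * y) : A.carrier) - f₁ x * f₁ y

variable {A}

namespace LiftPair

variable (c : A.LiftPair)

/-- The map `Φ₃ = m₂ (f₁ ⊗ f₂ - f₂ ⊗ f₁) - f₂ (m₂ ⊗ 1 - 1 ⊗ m₂)`, with the sign
`(f₁ ⊗ f₂)(x ⊗ y ⊗ z) = (-1) ^ |x| f₁(x) ⊗ f₂(y ⊗ z)`. -/
def Φ₃ (x y z : A.Cohomology) : A.carrier :=
  (A.inv (c.f₁ x) * c.f₂ y z - c.f₂ x y * c.f₁ z) - (c.f₂ (x * y) z - c.f₂ x (y * z))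

theorem d_f₁ (x : A.Cohomology) : A.d (c.f₁ x) = 0 := A.mem_cocycles.1 (c.f₁ x).2

theorem d_inv_f₁ (x : A.Cohomology) : A.d (A.inv (c.f₁ x)) = 0 := by
  rw [d_inv, d_f₁, map_zero, neg_zero]

theorem d_Φ₃ (x y z : A.Cohomology) : A.d (c.Φ₃ x y z) = 0 := by
  simp only [Φ₃, map_sub, d_mul, d_f₂, d_f₁, d_inv_f₁, inv_inv]
  rw [mul_assoc x y z]
  noncomm_ring

theorem Φ₃_mem {i j k : ℤ} {x y z : A.Cohomology} (hx : x ∈ A.cohomologyGr i)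
    (hy : y ∈ A.cohomologyGr j) (hz : z ∈ A.cohomologyGr k) :
    c.Φ₃ x y z ∈ A.gr (i + j + k - 1) := by
  refine sub_mem (sub_mem ?_ ?_) (sub_mem ?_ ?_)
  · rw [A.inv_of_mem (c.f₁_mem i x hx), smul_mul_assoc]
    refine Submodule.smul_mem _ _ ?_
    have := SetLike.mul_mem_graded (c.f₁_mem i x hx) (c.f₂_mem j k y z hy hz)
    rwa [show i + (j + k - 1) = i + j + k - 1 by ring] at this
  · have := SetLike.mul_mem_graded (c.f₂_mem i j x y hx hy) (c.f₁_mem k z hz)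
    rwa [show i + j - 1 + k = i + j + k - 1 by ring] at this
  · exact c.f₂_mem (i + j) k (x * y) z (SetLike.mul_mem_graded hx hy) hz
  · have := c.f₂_mem i (j + k) x (y * z) hx (SetLike.mul_mem_graded hy hz)
    rwa [show i + (j + k) - 1 = i + j + k - 1 by ring] at this

/-- The cohomology class of `Φ₃(x, y, z)`. -/
def m₃val (x y z : A.Cohomology) : A.Cohomology := A.cls ⟨c.Φ₃ x y z, c.d_Φ₃ x y z⟩

theorem m₃val_add₁ (x x' y z : A.Cohomology) :
    c.m₃val (x + x') y z = c.m₃val x y z + c.m₃val x' y z := by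
  rw [m₃val, m₃val, m₃val, ← map_add]
  congr 1
  apply Subtype.ext
  simp only [Φ₃, map_add, LinearMap.add_apply, Subalgebra.coe_add, add_mul]
  abel

theorem m₃val_add₂ (x y y' z : A.Cohomology) :
    c.m₃val x (y + y') z = c.m₃val x y z + c.m₃val x y' z := by
  rw [m₃val, m₃val, m₃val, ← map_add]
  congr 1
  apply Subtype.ext
  simp only [Φ₃, map_add, LinearMap.add_apply, Subalgebra.coe_add, add_mul, mul_add]
  abel

theorem m₃val_add₃ (x y z z' : A.Cohomology) :
    c.m₃val x y (z + z') = c.m₃val x y z + c.m₃val x y z' := by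
  rw [m₃val, m₃val, m₃val, ← map_add]
  congr 1
  apply Subtype.ext
  simp only [Φ₃, map_add, Subalgebra.coe_add, mul_add]
  abel

theorem m₃val_smul₁ (r : F) (x y z : A.Cohomology) :
    c.m₃val (r • x) y z = r • c.m₃val x y z := by
  rw [m₃val, m₃val, ← map_smul]
  congr 1
  apply Subtype.ext
  simp only [Φ₃, map_smul, LinearMap.smul_apply, Subalgebra.coe_smul, smul_mul_assoc, smul_sub]

theorem m₃val_smul₂ (r : F) (x y z : A.Cohomology) :
    c.m₃val x (r • y) z = r • c.m₃val x y z := by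
  rw [m₃val, m₃val, ← map_smul]
  congr 1
  apply Subtype.ext
  simp only [Φ₃, map_smul, LinearMap.smul_apply, Subalgebra.coe_smul, smul_mul_assoc,
    mul_smul_comm, smul_sub]

theorem m₃val_smul₃ (r : F) (x y z : A.Cohomology) :
    c.m₃val x y (r • z) = r • c.m₃val x y z := by
  rw [m₃val, m₃val, ← map_smul]
  congr 1
  apply Subtype.ext
  simp only [Φ₃, map_smul, Subalgebra.coe_smul, mul_smul_comm, smul_sub]

/-- The map `m₃ : H^•(A)^{⊗ 3} → H^•(A)[-1]` induced by `Φ₃`. -/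
def m₃ : MultilinearMap F (fun _ : Fin 3 => A.Cohomology) A.Cohomology :=
  MultilinearMap.mk' (fun a => c.m₃val (a 0) (a 1) (a 2))
    (fun a i x y => by
      fin_cases i
      · simpa [Function.update] using c.m₃val_add₁ x y (a 1) (a 2)
      · simpa [Function.update] using c.m₃val_add₂ (a 0) x y (a 2)
      · simpa [Function.update] using c.m₃val_add₃ (a 0) (a 1) x y)
    (fun a i r x => by
      fin_cases i
      · simpa [Function.update] using c.m₃val_smul₁ r x (a 1) (a 2)
      · simpa [Function.update] using c.m₃val_smul₂ r (a 0) x (a 2)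
      · simpa [Function.update] using c.m₃val_smul₃ r (a 0) (a 1) x)

theorem m₃_apply (a : Fin 3 → A.Cohomology) :
    c.m₃ a = A.cls ⟨c.Φ₃ (a 0) (a 1) (a 2), c.d_Φ₃ _ _ _⟩ := rfl

theorem signTwist_eq (x : A.Cohomology) :
    signTwist A.cohomologyGr (-1) x = A.cls ⟨A.inv (c.f₁ x), A.mem_cocycles.2 (c.d_inv_f₁ x)⟩ := by
  obtain ⟨h, e⟩ := A.signTwist_cls (c.f₁ x)
  rw [c.cls_f₁] at e
  exact e

theorem m₃val_eq (x y z : A.Cohomology) :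
    c.m₃ ![x, y, z] = A.cls ⟨c.Φ₃ x y z, c.d_Φ₃ x y z⟩ := rfl

theorem differential_m₃ : hochschildDifferential A.cohomologyGr (-1) 3 c.m₃ = 0 := by
  ext a
  obtain ⟨w, x, y, z, rfl⟩ : ∃ w x y z, a = ![w, x, y, z] :=
    ⟨a 0, a 1, a 2, a 3, by ext i; fin_cases i <;> rfl⟩
  rw [hochschildDifferential_three, c.signTwist_eq]
  conv_lhs => enter [2, 2]; rw [← c.cls_f₁ z]
  simp only [m₃val_eq, ← cls_mul, ← map_sub, ← map_add]
  rw [zero_apply, cls_eq_zero]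
  refine ⟨A.inv (c.f₂ w x) * c.f₂ y z, ?_⟩
  rw [d_mul, d_inv, inv_inv, d_f₂, d_f₂, map_sub, inv_mul]
  simp only [Subalgebra.coe_add, Subalgebra.coe_sub, Subalgebra.coe_mul, Φ₃]
  rw [mul_assoc w x y, mul_assoc x y z]
  noncomm_ring

theorem m₃_mem_cocycles : c.m₃ ∈ hochschildCocycles A.cohomologyGr 3 (-1) := by
  refine ⟨fun i a h => ?_, c.differential_m₃⟩
  refine ⟨⟨c.Φ₃ (a 0) (a 1) (a 2), c.d_Φ₃ _ _ _⟩, ?_, rfl⟩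
  have := c.Φ₃_mem (h 0) (h 1) (h 2)
  rw [Fin.sum_univ_three]
  exact this

/-- The class `[m₃] ∈ HH^{3,-1}(H^•(A))` defined by a choice of `(f₁, f₂)`. -/
def hochschildClass : HH A.cohomologyGr 3 (-1) :=
  Submodule.Quotient.mk ⟨c.m₃, c.m₃_mem_cocycles⟩

end LiftPair

variable (A)

/-- There is a graded `h` of degree `-1` with `d h = id` on the coboundaries. -/
theorem exists_section_d : ∃ h : A.carrier →ₗ[F] A.carrier,
    (∀ i, ∀ a ∈ A.gr i, h a ∈ A.gr (i - 1)) ∧ ∀ a, A.d (h (A.d a)) = A.d a := by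
  have key : ∀ i : ℤ, ∃ h : A.gr i →ₗ[F] A.carrier, (∀ a, h a ∈ A.gr (i - 1)) ∧
      ∀ c ∈ A.gr (i - 1), ∀ e : A.d c ∈ A.gr i, A.d (h ⟨A.d c, e⟩) = A.d c := by
    intro i
    have hm : ∀ c : A.gr (i - 1), A.d c ∈ A.gr i := fun c => by
      have := A.d_mem _ _ c.2
      rwa [sub_add_cancel] at this
    let D : A.gr (i - 1) →ₗ[F] A.gr i := (A.d ∘ₗ (A.gr (i - 1)).subtype).codRestrict _ hm
    obtain ⟨T, hT⟩ := exists_linear_geninv D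
    refine ⟨(A.gr (i - 1)).subtype ∘ₗ T, fun a => (T a).2, fun c hc e => ?_⟩
    exact congrArg Subtype.val (hT ⟨c, hc⟩)
  choose h h1 h2 using key
  refine ⟨assemble A.gr h, fun i a ha => ?_, fun a => ?_⟩
  · rw [assemble_of_mem A.gr h ha]
    exact h1 i _
  · refine graded_ext A.gr (f := A.d ∘ₗ assemble A.gr h ∘ₗ A.d) (g := A.d) (fun i a ha => ?_) a
    simp only [LinearMap.comp_apply]
    rw [assemble_of_mem A.gr h (A.d_mem i a ha)]
    exact h2 (i + 1) a (by rwa [add_sub_cancel_right]) _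

theorem exists_section_cls : ∃ f : A.Cohomology →ₗ[F] A.cocycles,
    (∀ (i : ℤ) (x : A.Cohomology), x ∈ A.cohomologyGr i → (f x : A.carrier) ∈ A.gr i) ∧
    ∀ x, A.cls (f x) = x := by
  have key : ∀ i : ℤ, ∃ f : A.cohomologyGr i →ₗ[F] A.cocycles,
      (∀ x, (f x : A.carrier) ∈ A.gr i) ∧ ∀ x, A.cls (f x) = x := by
    intro i
    let p : ((A.gr i).comap A.cocycles.val.toLinearMap) →ₗ[F] A.cohomologyGr i :=
      A.cls.restrict (fun a ha => ⟨a, ha, rfl⟩)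
    have hp : Function.Surjective p := by
      rintro ⟨x, a, ha, rfl⟩
      exact ⟨⟨a, ha⟩, rfl⟩
    obtain ⟨S, hS⟩ := exists_linear_section p hp
    exact ⟨Submodule.subtype _ ∘ₗ S, fun x => (S x).2,
      fun x => congrArg Subtype.val (hS x)⟩
  choose f h1 h2 using key
  refine ⟨assemble A.cohomologyGr f, fun i x hx => ?_, fun x => ?_⟩
  · rw [assemble_of_mem A.cohomologyGr f hx]
    exact h1 i _
  · refine graded_ext A.cohomologyGr (f := A.cls ∘ₗ assemble A.cohomologyGr f)
      (g := LinearMap.id) (fun i x hx => ?_) x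
    simp only [LinearMap.comp_apply, LinearMap.id_apply]
    rw [assemble_of_mem A.cohomologyGr f hx]
    exact h2 i _

instance : Nonempty A.LiftPair := by
  obtain ⟨h, h1, h2⟩ := A.exists_section_d
  obtain ⟨f, f1, f2⟩ := A.exists_section_cls
  let g : A.Cohomology →ₗ[F] A.carrier := A.cocycles.val.toLinearMap ∘ₗ f
  let B : A.Cohomology →ₗ[F] A.Cohomology →ₗ[F] A.carrier :=
    (LinearMap.mul F A.Cohomology).compr₂ g - (LinearMap.mul F A.carrier).compl₁₂ g g
  have hB : ∀ x y, B x y = (f (x * y) : A.carrier) - f x * f y := fun x y => rfl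
  refine ⟨⟨f, f1, f2, B.compr₂ h, fun i j x y hx hy => ?_, fun x y => ?_⟩⟩
  · rw [LinearMap.compr₂_apply, hB]
    exact h1 _ _ (sub_mem (f1 _ _ (SetLike.mul_mem_graded hx hy))
      (SetLike.mul_mem_graded (f1 _ _ hx) (f1 _ _ hy)))
  · rw [LinearMap.compr₂_apply]
    have : A.cls (f (x * y) - f x * f y) = 0 := by
      rw [map_sub, cls_mul, f2, f2, f2, sub_self]
    obtain ⟨a, ha⟩ := A.cls_eq_zero.1 this
    have e : B x y = A.d a := ha.symm
    rw [e, h2, ← e, hB]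

/-- The canonical class `γ_A ∈ HH^{3,-1}(H^•(A))` of a differential graded algebra: the class
`[m₃]` for a choice of `(f₁, f₂)`. -/
def canonicalClass : HH A.cohomologyGr 3 (-1) :=
  (Classical.arbitrary A.LiftPair).hochschildClass

variable {A}

/-- The class `[m₃]` does not depend on the choice of `(f₁, f₂)`. -/
theorem LiftPair.hochschildClass_eq (c c' : A.LiftPair) :
    c.hochschildClass = c'.hochschildClass := by
  obtain ⟨h, h1, h2⟩ := A.exists_section_d
  let i : A.cocycles →ₗ[F] A.carrier := A.cocycles.val.toLinearMap
  let g : A.Cohomology →ₗ[F] A.carrier := h ∘ₗ i ∘ₗ (c'.f₁ - c.f₁)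
  have hg : ∀ x, A.d (g x) = (c'.f₁ x : A.carrier) - c.f₁ x := by
    intro x
    have : A.cls (c'.f₁ x - c.f₁ x) = 0 := by
      rw [map_sub, c.cls_f₁, c'.cls_f₁, sub_self]
    obtain ⟨a, ha⟩ := A.cls_eq_zero.1 this
    have e : i ((c'.f₁ - c.f₁) x) = A.d a := ha.symm
    simp only [g, LinearMap.comp_apply]
    rw [e, h2, ha]
    rfl
  have hgm : ∀ j, ∀ x ∈ A.cohomologyGr j, g x ∈ A.gr (j - 1) := fun j x hx =>
    h1 _ _ (sub_mem (c'.f₁_mem j x hx) (c.f₁_mem j x hx))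
  let M := LinearMap.mul F A.carrier
  let t : A.Cohomology →ₗ[F] A.Cohomology →ₗ[F] A.carrier :=
    c'.f₂ - c.f₂ - (LinearMap.mul F A.Cohomology).compr₂ g + M.compl₁₂ g (i ∘ₗ c'.f₁) +
      M.compl₁₂ (A.inv ∘ₗ i ∘ₗ c.f₁) g
  have ht : ∀ x y, t x y = c'.f₂ x y - c.f₂ x y - g (x * y) + g x * c'.f₁ y +
      A.inv (c.f₁ x) * g y := fun x y => rfl
  have htd : ∀ x y, t x y ∈ A.cocycles := by
    intro x y
    rw [mem_cocycles, ht]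
    simp only [map_sub, map_add, d_mul, d_f₂, d_f₁, d_inv_f₁, inv_inv, hg]
    noncomm_ring
  have htm : ∀ {j k x y}, x ∈ A.cohomologyGr j → y ∈ A.cohomologyGr k →
      t x y ∈ A.gr (j + k - 1) := by
    intro j k x y hx hy
    rw [ht]
    refine add_mem (add_mem (sub_mem (sub_mem (c'.f₂_mem j k x y hx hy) (c.f₂_mem j k x y hx hy))
      (hgm _ _ (SetLike.mul_mem_graded hx hy))) ?_) ?_
    · have := SetLike.mul_mem_graded (hgm j x hx) (c'.f₁_mem k y hy)
      rwa [show j - 1 + k = j + k - 1 by ring] at this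
    · rw [A.inv_of_mem (c.f₁_mem j x hx), smul_mul_assoc]
      have := SetLike.mul_mem_graded (c.f₁_mem j x hx) (hgm k y hy)
      rw [show j + (k - 1) = j + k - 1 by ring] at this
      exact Submodule.smul_mem _ _ this
  have cls_congr : ∀ {a b : A.carrier} (ha : a ∈ A.cocycles) (hb : b ∈ A.cocycles), a = b →
      A.cls ⟨a, ha⟩ = A.cls ⟨b, hb⟩ := by
    rintro a b ha hb rfl; rfl
  let η : MultilinearMap F (fun _ : Fin 2 => A.Cohomology) A.Cohomology :=
    MultilinearMap.mk' (fun a => A.cls ⟨t (a 0) (a 1), htd _ _⟩)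
      (fun a i x y => by
        rw [← map_add]
        fin_cases i
        · exact cls_congr _ _ (by simp [Function.update])
        · exact cls_congr _ _ (by simp [Function.update]))
      (fun a i r x => by
        rw [← map_smul]
        fin_cases i
        · exact cls_congr _ _ (by simp [Function.update])
        · exact cls_congr _ _ (by simp [Function.update]))
  have hη : ∀ x y, η ![x, y] = A.cls ⟨t x y, htd x y⟩ := fun x y => rfl
  symm
  rw [LiftPair.hochschildClass, LiftPair.hochschildClass, Submodule.Quotient.eq]
  refine ⟨η, fun j a ha => ⟨⟨t (a 0) (a 1), htd _ _⟩, ?_, rfl⟩, ?_⟩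
  · rw [Fin.sum_univ_two]
    exact htm (ha 0) (ha 1)
  · ext a
    obtain ⟨x, y, z, rfl⟩ : ∃ x y z, a = ![x, y, z] :=
      ⟨a 0, a 1, a 2, by ext i; fin_cases i <;> rfl⟩
    change hochschildDifferential A.cohomologyGr (-1) 2 η ![x, y, z] =
      c'.m₃ ![x, y, z] - c.m₃ ![x, y, z]
    rw [← sub_eq_zero, hochschildDifferential_two, c.signTwist_eq]
    conv_lhs => enter [1, 2, 2]; rw [← c'.cls_f₁ z]
    simp only [m₃val_eq, hη, ← cls_mul, ← map_sub, ← map_add]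
    rw [cls_eq_zero]
    refine ⟨A.inv (g x) * c'.f₂ y z + A.inv (c.f₂ x y) * g z, ?_⟩
    simp only [Subalgebra.coe_add, Subalgebra.coe_sub, Subalgebra.coe_mul, Φ₃, ht, map_add, d_mul,
      d_inv, inv_inv, d_f₂, hg, map_sub, inv_mul]
    rw [mul_assoc x y z]
    noncomm_ring

theorem canonicalClass_eq (c : A.LiftPair) : A.canonicalClass = c.hochschildClass :=
  LiftPair.hochschildClass_eq _ c

end DGAlgebra

/-! ### `A₃`-algebras and `A₃`-formality -/

/-- An `A₃`-algebra over a field: a non-negatively graded vector space with one-dimensional part of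
degree `0` and with graded linear maps `mᵢ : V^{⊗ i} → V[2 - i]`, `i = 1, 2, 3`, satisfying
`m₁ m₁ = 0`, `m₁ m₂ = m₂ (m₁ ⊗ 1 + 1 ⊗ m₁)` and
`m₂ (1 ⊗ m₂ - m₂ ⊗ 1) = m₁ m₃ + m₃ (m₁ ⊗ 1 ⊗ 1 + 1 ⊗ m₁ ⊗ 1 + 1 ⊗ 1 ⊗ m₁)`. Signs come from
`(f ⊗ g)(x ⊗ y) = (-1) ^ (|g| |x|) f(x) ⊗ g(y)`. -/
structure A3Algebra (F : Type u) [Field F] where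
  carrier : Type v
  [addCommGroup : AddCommGroup carrier]
  [module : Module F carrier]
  gr : ℤ → Submodule F carrier
  [decomposition : DirectSum.Decomposition gr]
  gr_neg : ∀ i < 0, gr i = ⊥
  finrank_gr_zero : Module.finrank F (gr 0) = 1
  m₁ : carrier →ₗ[F] carrier
  m₂ : carrier →ₗ[F] carrier →ₗ[F] carrier
  m₃ : carrier →ₗ[F] carrier →ₗ[F] carrier →ₗ[F] carrier
  m₁_mem : ∀ (i : ℤ) (x : carrier), x ∈ gr i → m₁ x ∈ gr (i + 1)
  m₂_mem : ∀ (i j : ℤ) (x y : carrier), x ∈ gr i → y ∈ gr j → m₂ x y ∈ gr (i + j)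
  m₃_mem : ∀ (i j k : ℤ) (x y z : carrier), x ∈ gr i → y ∈ gr j → z ∈ gr k →
    m₃ x y z ∈ gr (i + j + k - 1)
  m₁_m₁ : ∀ x, m₁ (m₁ x) = 0
  m₁_m₂ : ∀ (i : ℤ) (x y : carrier), x ∈ gr i →
    m₁ (m₂ x y) = m₂ (m₁ x) y + (-1 : F) ^ i • m₂ x (m₁ y)
  m₂_m₂ : ∀ (i j : ℤ) (x y z : carrier), x ∈ gr i → y ∈ gr j →
    m₂ x (m₂ y z) - m₂ (m₂ x y) z =
      m₁ (m₃ x y z) + (m₃ (m₁ x) y z + (-1 : F) ^ i • m₃ x (m₁ y) z +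
        (-1 : F) ^ (i + j) • m₃ x y (m₁ z))

namespace A3Algebra

attribute [instance] A3Algebra.addCommGroup A3Algebra.module A3Algebra.decomposition

variable {F : Type u} [Field F]

/-- The cohomology of the complex underlying an `A₃`-algebra. -/
abbrev Cohomology (V : A3Algebra.{u, v} F) : Type v :=
  LinearMap.ker V.m₁ ⧸ (LinearMap.range V.m₁).comap (LinearMap.ker V.m₁).subtype

/-- An `A₃`-algebra is minimal if `m₁ = 0`. -/
def IsMinimal (V : A3Algebra.{u, v} F) : Prop := V.m₁ = 0

/-- A morphism of `A₃`-algebras: graded linear maps `fᵢ : V^{⊗ i} → W[1 - i]`, `i = 1, 2, 3`, with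
`f₁ m₁ = m₁ f₁`,
`f₁ m₂ - m₂ (f₁ ⊗ f₁) = m₁ f₂ + f₂ (m₁ ⊗ 1 + 1 ⊗ m₁)` and
`m₁ f₃ + m₂ (f₁ ⊗ f₂ - f₂ ⊗ f₁) + m₃ (f₁ ⊗ f₁ ⊗ f₁) = f₁ m₃ + f₂ (m₂ ⊗ 1 - 1 ⊗ m₂)
  + f₃ (m₁ ⊗ 1 ⊗ 1 + 1 ⊗ m₁ ⊗ 1 + 1 ⊗ 1 ⊗ m₁)`. -/
structure Hom (V : A3Algebra.{u, v} F) (W : A3Algebra.{u, w} F) where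
  f₁ : V.carrier →ₗ[F] W.carrier
  f₂ : V.carrier →ₗ[F] V.carrier →ₗ[F] W.carrier
  f₃ : V.carrier →ₗ[F] V.carrier →ₗ[F] V.carrier →ₗ[F] W.carrier
  f₁_mem : ∀ (i : ℤ) (x : V.carrier), x ∈ V.gr i → f₁ x ∈ W.gr i
  f₂_mem : ∀ (i j : ℤ) (x y : V.carrier), x ∈ V.gr i → y ∈ V.gr j → f₂ x y ∈ W.gr (i + j - 1)
  f₃_mem : ∀ (i j k : ℤ) (x y z : V.carrier), x ∈ V.gr i → y ∈ V.gr j → z ∈ V.gr k →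
    f₃ x y z ∈ W.gr (i + j + k - 2)
  map_m₁ : ∀ x, f₁ (V.m₁ x) = W.m₁ (f₁ x)
  map_m₂ : ∀ (i : ℤ) (x y : V.carrier), x ∈ V.gr i →
    f₁ (V.m₂ x y) - W.m₂ (f₁ x) (f₁ y) =
      W.m₁ (f₂ x y) + (f₂ (V.m₁ x) y + (-1 : F) ^ i • f₂ x (V.m₁ y))
  map_m₃ : ∀ (i j : ℤ) (x y z : V.carrier), x ∈ V.gr i → y ∈ V.gr j →
    W.m₁ (f₃ x y z) + ((-1 : F) ^ i • W.m₂ (f₁ x) (f₂ y z) - W.m₂ (f₂ x y) (f₁ z)) +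
        W.m₃ (f₁ x) (f₁ y) (f₁ z) =
      f₁ (V.m₃ x y z) + (f₂ (V.m₂ x y) z - f₂ x (V.m₂ y z)) +
        (f₃ (V.m₁ x) y z + (-1 : F) ^ i • f₃ x (V.m₁ y) z + (-1 : F) ^ (i + j) • f₃ x y (V.m₁ z))

/-- The map induced by `f₁` on cohomology. -/
def Hom.cohomologyMap {V : A3Algebra.{u, v} F} {W : A3Algebra.{u, w} F} (f : V.Hom W) :
    V.Cohomology →ₗ[F] W.Cohomology :=
  Submodule.mapQ _ _ (f.f₁.restrict (p := LinearMap.ker V.m₁) (q := LinearMap.ker W.m₁)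
    (fun x hx => by
      rw [LinearMap.mem_ker] at hx ⊢
      rw [← f.map_m₁, hx, map_zero]))
    (by
      rintro x ⟨y, hy⟩
      exact ⟨f.f₁ y, by rw [← f.map_m₁, hy]; rfl⟩)

/-- A morphism of `A₃`-algebras is a quasi-isomorphism if `f₁` is a quasi-isomorphism. -/
def Hom.IsQuasiIso {V : A3Algebra.{u, v} F} {W : A3Algebra.{u, w} F} (f : V.Hom W) : Prop :=
  Function.Bijective f.cohomologyMap

end A3Algebra

namespace DGAlgebra

variable {F : Type u} [Field F]

/-- A connected differential graded algebra as an `A₃`-algebra with `m₁ = d`, `m₂` the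
multiplication and `m₃ = 0`. -/
def toA3Algebra (A : DGAlgebra.{u, v} F) (hA : A.IsConnected) : A3Algebra.{u, v} F where
  carrier := A.carrier
  gr := A.gr
  gr_neg := hA.1
  finrank_gr_zero := by
    rw [hA.2.2, Submodule.one_eq_range, LinearMap.finrank_range_of_inj hA.2.1,
      Module.finrank_self]
  m₁ := A.d
  m₂ := LinearMap.mul F A.carrier
  m₃ := 0
  m₁_mem := A.d_mem
  m₂_mem _ _ _ _ hx hy := SetLike.mul_mem_graded hx hy
  m₃_mem _ _ _ _ _ _ _ _ _ := zero_mem _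
  m₁_m₁ := A.d_d
  m₁_m₂ i x y hx := A.leibniz i x y hx
  m₂_m₂ i j x y z _ _ := by simp [mul_assoc]

/-- A connected differential graded algebra is `A₃`-formal if it has a minimal `A₃`-model, that is,
a minimal `A₃`-algebra `M` with a quasi-isomorphism of `A₃`-algebras `M → A`, such that `m₃ = 0`
on `M`. -/
def IsA3Formal (A : DGAlgebra.{u, v} F) (hA : A.IsConnected) : Prop :=
  ∃ (M : A3Algebra.{u, v} F) (f : M.Hom (A.toA3Algebra hA)),
    M.IsMinimal ∧ f.IsQuasiIso ∧ M.m₃ = 0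

end DGAlgebra

/-! ### Continuous inhomogeneous cochains -/

section Cochains

variable (F : Type u) [Field F] [TopologicalSpace F] [DiscreteTopology F]
  (G : Type v) [Group G] [TopologicalSpace G] [IsTopologicalGroup G]

/-- The continuous inhomogeneous `n`-cochains `C^n(G, F)`: continuous functions `G^n → F`, where `F`
is discrete. -/
abbrev Cochain (n : ℕ) : Type (max u v) := C(Fin n → G, F)

variable {F G}

theorem continuous_contractNth {n : ℕ} (j : Fin (n + 1)) :
    Continuous fun g : Fin (n + 1) → G => Fin.contractNth j (· * ·) g := by
  refine continuous_pi fun k => ?_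
  simp only [Fin.contractNth]
  split_ifs <;> fun_prop

/-- The differential `δ : C^n(G, F) → C^{n+1}(G, F)` for the trivial action,
`(δ φ)(g₁, …, gₙ₊₁) = φ(g₂, …, gₙ₊₁) + ∑ⱼ (-1) ^ j φ(g₁, …, gⱼ gⱼ₊₁, …, gₙ₊₁)
  + (-1) ^ (n + 1) φ(g₁, …, gₙ)`. -/
def coboundary (n : ℕ) : Cochain F G n →ₗ[F] Cochain F G (n + 1) where
  toFun φ :=
    { toFun := fun g => φ (Fin.tail g) +
        ∑ j : Fin n, (-1 : F) ^ (j.val + 1) * φ (Fin.contractNth j.castSucc (· * ·) g) +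
        (-1 : F) ^ (n + 1) * φ (Fin.init g)
      continuous_toFun := by
        have h1 : Continuous fun g : Fin (n + 1) → G => Fin.tail g :=
          continuous_pi fun k => continuous_apply _
        have h2 : Continuous fun g : Fin (n + 1) → G => Fin.init g :=
          continuous_pi fun k => continuous_apply _
        have h3 := fun j : Fin n => continuous_contractNth (G := G) j.castSucc
        fun_prop }
  map_add' φ ψ := by
    ext g
    simp [mul_add, Finset.sum_add_distrib]
    abel
  map_smul' r φ := by
    ext g
    simp [mul_add, Finset.mul_sum, mul_left_comm]

/-- The cup product `(φ ∪ ψ)(g₁, …, gᵢ₊ⱼ) = φ(g₁, …, gᵢ) ψ(gᵢ₊₁, …, gᵢ₊ⱼ)` of cochains. -/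
def cup {i j : ℕ} (φ : Cochain F G i) (ψ : Cochain F G j) : Cochain F G (i + j) where
  toFun g := φ (fun t => g (Fin.castAdd j t)) * ψ (fun t => g (Fin.natAdd i t))
  continuous_toFun := by fun_prop

theorem cochain_mk_eq {n m : ℕ} (h : n = m) (φ : Cochain F G n) (ψ : Cochain F G m)
    (e : ∀ g : Fin m → G, φ (fun t => g (Fin.cast h t)) = ψ g) :
    GradedMonoid.mk (A := Cochain F G) n φ = GradedMonoid.mk m ψ := by
  subst h
  exact congrArg _ (ContinuousMap.ext e)

theorem cup_apply {i j : ℕ} (φ : Cochain F G i) (ψ : Cochain F G j) (g : Fin (i + j) → G) :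
    cup φ ψ g = φ (fun t => g (Fin.castAdd j t)) * ψ (fun t => g (Fin.natAdd i t)) := rfl

theorem const_cup (r : F) {n : ℕ} (φ : Cochain F G n) :
    GradedMonoid.mk (A := Cochain F G) (0 + n) (cup (ContinuousMap.const (Fin 0 → G) r) φ) =
      GradedMonoid.mk n (r • φ) := by
  refine cochain_mk_eq (zero_add n) _ _ fun g => ?_
  rw [cup_apply, ContinuousMap.const_apply, ContinuousMap.smul_apply, smul_eq_mul]
  congr 2
  ext t
  congr 1
  ext
  simp

theorem cup_const (r : F) {n : ℕ} (φ : Cochain F G n) :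
    GradedMonoid.mk (A := Cochain F G) (n + 0) (cup φ (ContinuousMap.const (Fin 0 → G) r)) =
      GradedMonoid.mk n (r • φ) := by
  refine cochain_mk_eq (add_zero n) _ _ fun g => ?_
  rw [cup_apply, ContinuousMap.const_apply, ContinuousMap.smul_apply, smul_eq_mul, mul_comm]
  rfl

theorem cup_assoc {i j k : ℕ} (φ : Cochain F G i) (ψ : Cochain F G j) (χ : Cochain F G k) :
    GradedMonoid.mk (A := Cochain F G) (i + j + k) (cup (cup φ ψ) χ) =
      GradedMonoid.mk (i + (j + k)) (cup φ (cup ψ χ)) := by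
  refine cochain_mk_eq (add_assoc i j k) _ _ fun g => ?_
  simp only [cup_apply, mul_assoc]
  congr 3
  ext t
  congr 1
  ext
  simp [add_assoc]

instance : GradedMonoid.GMul (Cochain F G) where
  mul φ ψ := cup φ ψ

instance : GradedMonoid.GOne (Cochain F G) where
  one := ContinuousMap.const _ 1

instance : DirectSum.GSemiring (Cochain F G) where
  mul_zero φ := by ext g; simp [GradedMonoid.GMul.mul, cup_apply]
  zero_mul φ := by ext g; simp [GradedMonoid.GMul.mul, cup_apply]
  mul_add φ ψ χ := by ext g; simp [GradedMonoid.GMul.mul, cup_apply, mul_add]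
  add_mul φ ψ χ := by ext g; simp [GradedMonoid.GMul.mul, cup_apply, add_mul]
  one_mul := by
    rintro ⟨n, φ⟩
    refine (const_cup 1 φ).trans ?_
    rw [one_smul]
    rfl
  mul_one := by
    rintro ⟨n, φ⟩
    refine (cup_const 1 φ).trans ?_
    rw [one_smul]
    rfl
  mul_assoc := by
    rintro ⟨i, φ⟩ ⟨j, ψ⟩ ⟨k, χ⟩
    exact cup_assoc φ ψ χ
  natCast n := ContinuousMap.const _ (n : F)
  natCast_zero := ContinuousMap.ext fun g => Nat.cast_zero
  natCast_succ n := ContinuousMap.ext fun g => Nat.cast_succ n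

instance : DirectSum.GRing (Cochain F G) where
  intCast n := ContinuousMap.const _ (n : F)
  intCast_ofNat n := ContinuousMap.ext fun _ => Int.cast_natCast n
  intCast_negSucc_ofNat n := ContinuousMap.ext fun _ => Int.cast_negSucc n

instance : DirectSum.GAlgebra F (Cochain F G) where
  toFun :=
    { toFun := fun r => ContinuousMap.const _ r
      map_zero' := rfl
      map_add' := fun _ _ => rfl }
  map_one := rfl
  map_mul r s := (const_cup r (ContinuousMap.const _ s)).symm
  commutes := by
    rintro r ⟨n, φ⟩
    exact (const_cup r φ).trans (cup_const r φ).symm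
  smul_def := by
    rintro r ⟨n, φ⟩
    exact (const_cup r φ).symm

/-- The underlying algebra of `C^•(G, F)`: the direct sum of the `C^n(G, F)` with the product
induced by the cup product. -/
abbrev CochainAlgebra (F : Type u) [Field F] [TopologicalSpace F] [DiscreteTopology F]
    (G : Type v) [Group G] [TopologicalSpace G] [IsTopologicalGroup G] : Type (max u v) :=
  ⨁ n, Cochain F G n

/-! Computations with cochains on initial segments of sequences. -/

/-- The `k`-th face of a sequence of group elements. -/
def face (k : ℕ) (s : ℕ → G) (t : ℕ) : G :=
  if t + 1 < k then s t else if t + 1 = k then s t * s (t + 1) else s (t + 1)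

theorem face_face (s : ℕ → G) {k l : ℕ} (h : l < k) :
    face l (face k s) = face (k - 1) (face l s) := by
  ext t
  unfold face
  split_ifs <;> first | omega | rfl | skip
  all_goals simp [mul_assoc]

theorem coboundary_apply_seq {n : ℕ} (φ : Cochain F G n) (s : ℕ → G) :
    coboundary n φ (fun t => s t) =
      ∑ k ∈ Finset.range (n + 2), (-1 : F) ^ k * φ (fun t => face k s t) := by
  rw [Finset.sum_range_succ, Finset.sum_range_succ']
  change φ _ + ∑ j : Fin n, (-1 : F) ^ (j.val + 1) * φ _ + (-1 : F) ^ (n + 1) * φ _ = _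
  rw [← Fin.sum_univ_eq_sum_range (fun k => (-1 : F) ^ (k + 1) * φ (fun t => face (k + 1) s t)) n,
    add_comm (φ _)]
  congr 1
  · congr 1
    · refine Finset.sum_congr rfl fun j _ => ?_
      congr 2
      ext t
      simp only [Fin.contractNth, face, Fin.val_castSucc, Fin.val_succ, add_lt_add_iff_right,
        add_left_inj]
    · rw [pow_zero, one_mul]
      congr 1
  · congr 2
    ext t
    simp [face, Fin.init]

theorem exists_seq {n : ℕ} (g : Fin n → G) : ∃ s : ℕ → G, g = fun t : Fin n => s t :=
  ⟨fun t => if h : t < n then g ⟨t, h⟩ else 1, by ext t; simp⟩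

theorem alternating_double_sum (m : ℕ) (a : ℕ → ℕ → F)
    (h : ∀ k l, l < k → a k l = a l (k - 1)) :
    ∑ k ∈ Finset.range (m + 1), ∑ l ∈ Finset.range m, (-1 : F) ^ (k + l) * a k l = 0 := by
  rw [← Finset.sum_product']
  refine Finset.sum_involution
    (fun p _ => if p.2 < p.1 then (p.2, p.1 - 1) else (p.2 + 1, p.1)) ?_ ?_ ?_ ?_
  · rintro ⟨k, l⟩ hp
    by_cases hkl : l < k
    · simp only [hkl, if_true]
      rw [h k l hkl]
      have e : (-1 : F) ^ (k + l) = - (-1) ^ (l + (k - 1)) := by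
        rw [show k + l = l + (k - 1) + 1 by omega, pow_succ]; ring
      rw [e]; ring
    · simp only [hkl, if_false]
      have e := h (l + 1) k (by omega)
      rw [add_tsub_cancel_right] at e
      rw [e, show l + 1 + k = k + l + 1 by omega, pow_succ]; ring
  · rintro ⟨k, l⟩ hp _ heq
    by_cases hkl : l < k
    · simp only [hkl, if_true, Prod.mk.injEq] at heq; omega
    · simp only [hkl, if_false, Prod.mk.injEq] at heq; omega
  · rintro ⟨k, l⟩ hp
    simp only [Finset.mem_product, Finset.mem_range] at hp ⊢
    split_ifs <;> simp <;> omega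
  · rintro ⟨k, l⟩ hp
    simp only
    by_cases hkl : l < k
    · have : ¬ (k - 1 < l) := by omega
      simp only [hkl, if_true, this, if_false]
      ext <;> simp; omega
    · have : k < l + 1 := by omega
      simp [hkl, this]

theorem coboundary_coboundary {n : ℕ} (φ : Cochain F G n) :
    coboundary (n + 1) (coboundary n φ) = 0 := by
  ext g
  obtain ⟨s, rfl⟩ := exists_seq g
  rw [coboundary_apply_seq]
  simp only [coboundary_apply_seq, Finset.mul_sum, ← mul_assoc, ← pow_add]
  refine alternating_double_sum (n + 2) (fun k l => φ fun t => face l (face k s) t)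
    fun k l h => ?_
  simp only [face_face s h]

theorem coboundary_cup_seq {i j : ℕ} (φ : Cochain F G i) (ψ : Cochain F G j) (s : ℕ → G) :
    coboundary (i + j) (cup φ ψ) (fun t => s t) =
      coboundary i φ (fun t => s t) * ψ (fun t => s (i + 1 + t)) +
        (-1 : F) ^ i * (φ (fun t => s t) * coboundary j ψ (fun t => s (i + t))) := by
  rw [coboundary_apply_seq, coboundary_apply_seq, coboundary_apply_seq ψ (fun t => s (i + t))]
  simp only [cup_apply, Fin.val_castAdd, Fin.val_natAdd]
  rw [show i + j + 2 = (i + 1) + (j + 1) by omega, Finset.sum_range_add,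
    Finset.sum_range_succ _ (i + 1), Finset.sum_range_succ' _ (j + 1)]
  have e1 : ∀ k ∈ Finset.range (i + 1), (-1 : F) ^ k * (φ (fun t => face k s t) *
      ψ (fun t => face k s (i + t))) =
      (-1 : F) ^ k * φ (fun t => face k s t) * ψ (fun t => s (i + 1 + t)) := by
    intro k hk
    rw [Finset.mem_range] at hk
    rw [mul_assoc]
    congr 3
    ext t
    simp only [face]
    rw [if_neg (by omega), if_neg (by omega)]
    congr 1; omega
  have e2 : ∀ k ∈ Finset.range (j + 1), (-1 : F) ^ (i + 1 + k) *
      (φ (fun t => face (i + 1 + k) s t) * ψ (fun t => face (i + 1 + k) s (i + t))) =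
      (-1 : F) ^ i * (φ (fun t => s t) * ((-1 : F) ^ (k + 1) *
        ψ (fun t => face (k + 1) (fun t => s (i + t)) t))) := by
    intro k _
    have f1 : (fun t : Fin i => face (i + 1 + k) s t) = fun t : Fin i => s t := by
      ext t
      have := t.2
      simp only [face]
      rw [if_pos (by omega)]
    have f2 : (fun t : Fin j => face (i + 1 + k) s (i + t)) =
        fun t : Fin j => face (k + 1) (fun t => s (i + t)) t := by
      ext t
      simp only [face]
      split_ifs <;> first | omega | rfl
    rw [f1, f2, show i + 1 + k = i + (k + 1) by omega, pow_add]
    ring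
  have e3 : (fun t : Fin i => face (i + 1) s t) = fun t : Fin i => s t := by
    ext t
    have := t.2
    simp only [face]
    rw [if_pos (by omega)]
  have e4 : (fun t : Fin j => face 0 (fun t => s (i + t)) t) = fun t : Fin j => s (i + 1 + t) := by
    ext t
    simp only [face]
    rw [if_neg (by omega), if_neg (by omega)]
    congr 1; omega
  rw [Finset.sum_congr rfl e1, Finset.sum_congr rfl e2, e3, e4, ← Finset.sum_mul,
    ← Finset.mul_sum, ← Finset.mul_sum]
  ring

/-- The differential of `C^•(G, F)`. -/
def cochainD : CochainAlgebra F G →ₗ[F] CochainAlgebra F G :=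
  DirectSum.toModule F ℕ _ fun n => DirectSum.lof F ℕ (Cochain F G) (n + 1) ∘ₗ coboundary n

theorem cochainD_of {n : ℕ} (φ : Cochain F G n) :
    cochainD (DirectSum.of (Cochain F G) n φ) =
      DirectSum.of (Cochain F G) (n + 1) (coboundary n φ) := by
  rw [← DirectSum.lof_eq_of F, cochainD, DirectSum.toModule_lof]
  rfl

theorem cochain_of_eq {n m : ℕ} (h : n = m) (φ : Cochain F G n) (ψ : Cochain F G m)
    (e : ∀ s : ℕ → G, φ (fun t => s t) = ψ (fun t => s t)) :
    DirectSum.of (Cochain F G) n φ = DirectSum.of (Cochain F G) m ψ := by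
  subst h
  congr 1
  ext g
  obtain ⟨s, rfl⟩ := exists_seq g
  exact e s

theorem cochainD_mul_of {i j : ℕ} (φ : Cochain F G i) (ψ : Cochain F G j) :
    cochainD (DirectSum.of (Cochain F G) i φ * DirectSum.of (Cochain F G) j ψ) =
      cochainD (DirectSum.of (Cochain F G) i φ) * DirectSum.of (Cochain F G) j ψ +
        (-1 : F) ^ i • (DirectSum.of (Cochain F G) i φ *
          cochainD (DirectSum.of (Cochain F G) j ψ)) := by
  have key : ∀ {n m : ℕ} (_ : n = m) (a : Cochain F G n), ∃ b : Cochain F G m,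
      ∀ s : ℕ → G, a (fun t => s t) = b (fun t => s t) := by
    rintro n m rfl a
    exact ⟨a, fun _ => rfl⟩
  have h1 : i + 1 + j = i + j + 1 := by omega
  obtain ⟨a, ha⟩ := key h1 (cup (coboundary i φ) ψ)
  obtain ⟨b, hb⟩ := key (add_assoc i j 1).symm (cup φ (coboundary j ψ))
  simp only [DirectSum.of_mul_of, cochainD_of]
  change DirectSum.of (Cochain F G) (i + j + 1) (coboundary (i + j) (cup φ ψ)) =
    DirectSum.of (Cochain F G) (i + 1 + j) (cup (coboundary i φ) ψ) +
      (-1 : F) ^ i • DirectSum.of (Cochain F G) (i + (j + 1)) (cup φ (coboundary j ψ))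
  rw [cochain_of_eq h1 _ a ha, cochain_of_eq (add_assoc i j 1).symm _ b hb]
  simp only [← DirectSum.lof_eq_of F]
  rw [← map_smul, ← map_add]
  refine congrArg _ ?_
  ext g
  obtain ⟨s, rfl⟩ := exists_seq g
  rw [ContinuousMap.add_apply, ContinuousMap.smul_apply, ← ha, ← hb, coboundary_cup_seq,
    cup_apply, cup_apply]
  simp only [Fin.val_castAdd, Fin.val_natAdd, smul_eq_mul]

/-- The part of degree `k` of `C^•(G, F)`: cochains all of whose components in degrees different
from `k` vanish (so it is `C^k(G, F)` for `k ≥ 0` and zero for `k < 0`). -/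
def cochainGr (k : ℤ) : Submodule F (CochainAlgebra F G) where
  carrier := {x | ∀ n : ℕ, (n : ℤ) ≠ k → x n = 0}
  add_mem' {x y} hx hy n h := by rw [DirectSum.add_apply, hx n h, hy n h, add_zero]
  zero_mem' n _ := rfl
  smul_mem' r x hx n h := by rw [DirectSum.smul_apply, hx n h, smul_zero]

theorem of_mem_cochainGr {n : ℕ} (φ : Cochain F G n) :
    DirectSum.of (Cochain F G) n φ ∈ cochainGr (F := F) (G := G) n := fun m hm =>
  DirectSum.of_eq_of_ne _ _ _ (by simpa using hm)

theorem exists_of_mem_cochainGr {k : ℤ} {x : CochainAlgebra F G} (hx : x ∈ cochainGr k) :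
    x = 0 ∨ ∃ (n : ℕ) (φ : Cochain F G n), (n : ℤ) = k ∧ x = DirectSum.of (Cochain F G) n φ := by
  rcases lt_or_ge k 0 with hk | hk
  · left
    ext1 n
    exact hx n (by omega)
  · right
    lift k to ℕ using hk
    refine ⟨k, x k, rfl, ?_⟩
    ext1 m
    by_cases h : m = k
    · subst h
      rw [DirectSum.of_eq_same]
    · rw [DirectSum.of_eq_of_ne _ _ _ h]
      exact hx m (by exact_mod_cast h)

theorem isInternal_cochainGr : DirectSum.IsInternal (cochainGr (F := F) (G := G)) := by
  refine isInternal_of_proj _ (fun k => if 0 ≤ k then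
    DirectSum.lof F ℕ (Cochain F G) k.toNat ∘ₗ DirectSum.component F ℕ (Cochain F G) k.toNat
    else 0) ?_ ?_ ?_
  · intro k x hx
    rcases exists_of_mem_cochainGr hx with rfl | ⟨n, φ, rfl, rfl⟩
    · simp
    · simp [DirectSum.lof_eq_of, ← DirectSum.apply_eq_component]
  · intro k l hkl x hx
    rcases exists_of_mem_cochainGr hx with rfl | ⟨n, φ, rfl, rfl⟩
    · simp
    · split_ifs with hk
      · rw [LinearMap.comp_apply, ← DirectSum.apply_eq_component,
          DirectSum.of_eq_of_ne _ _ _ (by omega), map_zero]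
      · rfl
  · rw [eq_top_iff]
    rintro x -
    induction x using DirectSum.induction_on with
    | zero => exact zero_mem _
    | of n φ => exact Submodule.mem_iSup_of_mem (n : ℤ) (of_mem_cochainGr φ)
    | add x y hx hy => exact add_mem hx hy

instance : GradedAlgebra (cochainGr (F := F) (G := G)) :=
  { isInternal_cochainGr.chooseDecomposition with
    one_mem := of_mem_cochainGr (F := F) (G := G) (n := 0) (ContinuousMap.const _ 1)
    mul_mem := by
      intro i j x y hx hy
      rcases exists_of_mem_cochainGr hx with rfl | ⟨n, φ, rfl, rfl⟩
      · rw [zero_mul]; exact zero_mem _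
      rcases exists_of_mem_cochainGr hy with rfl | ⟨m, ψ, rfl, rfl⟩
      · rw [mul_zero]; exact zero_mem _
      rw [DirectSum.of_mul_of, ← Nat.cast_add]
      exact of_mem_cochainGr _ }

variable (F G)

/-- The differential graded algebra `C^•(G, F)` of continuous inhomogeneous cochains, with the cup
product. -/
def cochainDGA : DGAlgebra.{u, max u v} F where
  carrier := CochainAlgebra F G
  gr := cochainGr
  d := cochainD
  d_mem k x hx := by
    rcases exists_of_mem_cochainGr hx with rfl | ⟨n, φ, rfl, rfl⟩
    · rw [map_zero]; exact zero_mem _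
    · rw [cochainD_of]
      exact of_mem_cochainGr _
  d_d x := by
    induction x using DirectSum.induction_on with
    | zero => simp
    | of n φ => rw [cochainD_of, cochainD_of, coboundary_coboundary, map_zero]
    | add x y hx hy => rw [map_add, map_add, hx, hy, add_zero]
  leibniz k x y hx := by
    rcases exists_of_mem_cochainGr hx with rfl | ⟨n, φ, rfl, rfl⟩
    · simp
    induction y using DirectSum.induction_on with
    | zero => simp
    | of m ψ => rw [cochainD_mul_of, zpow_natCast]
    | add y z hy hz => rw [mul_add, map_add, hy, hz, map_add, mul_add, mul_add, smul_add]; abel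

theorem cochainDGA_isConnected : (cochainDGA F G).IsConnected := by
  have hc : ∀ r : F, algebraMap F (CochainAlgebra F G) r =
      DirectSum.of (Cochain F G) 0 (ContinuousMap.const _ r) := fun r => rfl
  refine ⟨fun i hi => ?_, fun r r' h => ?_, ?_⟩
  · rw [eq_bot_iff]
    intro x hx
    rcases exists_of_mem_cochainGr hx with rfl | ⟨n, φ, h, -⟩
    · exact zero_mem _
    · omega
  · have h' := (hc r).symm.trans (h.trans (hc r'))
    exact congrArg (fun φ : Cochain F G 0 => φ Fin.elim0) (DirectSum.of_injective 0 h')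
  · refine le_antisymm (fun x hx => ?_) ?_
    · rw [Submodule.one_eq_range]
      rcases exists_of_mem_cochainGr hx with rfl | ⟨n, φ, h, rfl⟩
      · exact zero_mem _
      · obtain rfl : n = 0 := by omega
        refine ⟨φ Fin.elim0, ?_⟩
        refine (hc _).trans ?_
        congr 1
        ext g
        rw [ContinuousMap.const_apply]
        congr 1
        exact Subsingleton.elim _ _
    · rw [Submodule.one_eq_range]
      rintro _ ⟨r, rfl⟩
      exact of_mem_cochainGr (F := F) (G := G) (n := 0) (ContinuousMap.const _ r)

end Cochains

/-! ### Pro-`p` groups given by generators and one relation -/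

/-- The commutator `[x, y] = x⁻¹ y⁻¹ x y`. -/
def comm {G : Type u} [Group G] (x y : G) : G := x⁻¹ * y⁻¹ * x * y

/-- The word `x₁ ^ q [x₁, x₂] [x₃, x₄] ⋯ [x_{d-1}, x_d]` in the free group on `x₁, …, x_d`, for
even `d` (the generator `xᵢ` has index `i - 1`). -/
def demushkinWord (d : ℕ) (hd : 2 ≤ d) (q : ℕ) : FreeGroup (Fin d) :=
  FreeGroup.of ⟨0, by omega⟩ ^ q *
    (List.ofFn fun i : Fin (d / 2) =>
      comm (FreeGroup.of (⟨2 * i.val, by omega⟩ : Fin d))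
        (FreeGroup.of ⟨2 * i.val + 1, by omega⟩)).prod

/-- `G` is the pro-`p` group with generators `x i` and the single relation `r = 1`: `G` is a pro-`p`
group, topologically generated by the `x i`, the relation holds in `G`, and every family of
elements of a finite `p`-group satisfying the relation is the image of `x` under a continuous
homomorphism from `G`. (As `G` is the inverse limit of its finite continuous quotients, the last
property then holds for all pro-`p` groups in place of finite `p`-groups.) -/
structure IsProPPresentation (p : ℕ) {ι : Type v} [Finite ι] (r : FreeGroup ι) {G : Type u}
    [Group G] [TopologicalSpace G] [IsTopologicalGroup G] (x : ι → G) : Prop where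
  compactSpace : CompactSpace G
  t2Space : T2Space G
  totallyDisconnectedSpace : TotallyDisconnectedSpace G
  index_eq : ∀ U : Subgroup G, U.Normal → IsOpen (U : Set G) → ∃ n : ℕ, U.index = p ^ n
  generates : Dense (Subgroup.closure (Set.range x) : Set G)
  relation : FreeGroup.lift x r = 1
  exists_hom : ∀ (P : Type) [Group P] [Finite P] [TopologicalSpace P] [DiscreteTopology P],
    IsPGroup p P → ∀ y : ι → P, FreeGroup.lift y r = 1 →
      ∃ φ : G →ₜ* P, ∀ i, φ (x i) = y i

end A3F

end

/-! Let `χ` be the character of the group that sends every generator to `1`. The obstruction is a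
restricted triple Massey product of `χ` with itself: choose `b` of degree `1` with `δ b = -χ ∪ χ`
and take the class of `χ ∪ b + b ∪ χ` in degree `2`, the same `b` standing on both sides. Such a `b`
exists because classes of degree `1` anticommute and `2` is invertible modulo `3`. Replacing `b` by
`b + z` with a cocycle `z` adds `χ ∪ z + z ∪ χ`, which is a coboundary, so the class does not depend
on `b`. With two independent bounding cochains there would be a genuine indeterminacy, and the
argument would break down.

This class is nonzero (`not_exists_d_eq_massey`). If `χ ∪ b + b ∪ χ = δ e`, then `χ`, `b`, `-e`
satisfy the addition laws of divided powers of degrees `1`, `2`, `3`, so `g ↦ 1 + χ(g) X + b(g) X² -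
e(g) X³` is a homomorphism to the units of `F[X] / (X⁴)`. These units form an abelian group, hence
all commutators in the relation disappear and the cube of the image of `x₁` must be `1`. In
characteristic `3` that cube is `1 + χ(x₁)³ X³`, which is not `1` (`false_of_dividedPowers`).

Each of the two properties to be refuted would make the class vanish. If `m₃` is the Hochschild
coboundary of `η`, then at `(X, X, X)`, with `X` the class of `χ`, the relation `X X = 0` leaves
only `-(X η(X, X) + η(X, X) X)`, which is zero by anticommutativity, while `m₃(X, X, X)` is minus
the restricted Massey product with `b = f₂(X, X)`. For a quasi-isomorphism from a minimal model with
`m₃ = 0`, the third morphism identity at the element over `χ` exhibits the product as the coboundary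
of a value of `f₃`. -/

namespace A3F

/-! ### Cochains of degree `1` and `2` as functions on the group -/

section OneCochains

variable {F : Type*} [Field F] [TopologicalSpace F] [DiscreteTopology F]
  {G : Type*} [Group G] [TopologicalSpace G] [IsTopologicalGroup G]

/-- A continuous function on `G`, as a cochain of degree `1`. -/
def oneCochain (f : C(G, F)) : Cochain F G 1 := f.comp ⟨fun g => g 0, by fun_prop⟩

theorem oneCochain_apply (f : C(G, F)) (g : Fin 1 → G) : oneCochain f g = f (g 0) := rfl

theorem exists_eq_oneCochain (φ : Cochain F G 1) : ∃ f : C(G, F), φ = oneCochain f := by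
  refine ⟨φ.comp ⟨fun g _ => g, by fun_prop⟩, ContinuousMap.ext fun g => ?_⟩
  change φ g = φ fun _ => g 0
  congr 1
  ext t
  rw [Subsingleton.elim t 0]

theorem coboundary_one_apply (f : C(G, F)) (g h : G) :
    coboundary 1 (oneCochain f) ![g, h] = f h - f (g * h) + f g := by
  simp only [coboundary, LinearMap.coe_mk, AddHom.coe_mk, ContinuousMap.coe_mk, oneCochain_apply]
  simp [Fin.tail, Fin.init, Fin.contractNth, sub_eq_add_neg]

theorem cup_oneCochain_apply (f f' : C(G, F)) (g h : G) :
    cup (oneCochain f) (oneCochain f') ![g, h] = f g * f' h := rfl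

theorem cochain_two_ext {φ ψ : Cochain F G (1 + 1)} (H : ∀ g h, φ ![g, h] = ψ ![g, h]) :
    φ = ψ := by
  refine ContinuousMap.ext fun (g : Fin 2 → G) => ?_
  obtain ⟨a, b, rfl⟩ : ∃ a b, g = ![a, b] := ⟨g 0, g 1, by ext i; fin_cases i <;> rfl⟩
  exact H a b

/-- The element of degree `1` of the cochain algebra given by a continuous function. -/
def oneElt (f : C(G, F)) : (cochainDGA F G).carrier := DirectSum.of (Cochain F G) 1 (oneCochain f)

/-- The element of degree `2` of the cochain algebra given by a `2`-cochain. -/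
def twoElt (φ : Cochain F G (1 + 1)) : (cochainDGA F G).carrier :=
  DirectSum.of (Cochain F G) (1 + 1) φ

theorem twoElt_injective : Function.Injective (twoElt (F := F) (G := G)) :=
  DirectSum.of_injective _

theorem twoElt_add (φ ψ : Cochain F G (1 + 1)) : twoElt (φ + ψ) = twoElt φ + twoElt ψ :=
  map_add (DirectSum.of (Cochain F G) (1 + 1)) φ ψ

theorem twoElt_neg (φ : Cochain F G (1 + 1)) : twoElt (-φ) = -twoElt φ :=
  map_neg (DirectSum.of (Cochain F G) (1 + 1)) φ

theorem twoElt_zero : twoElt (0 : Cochain F G (1 + 1)) = 0 :=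
  map_zero (DirectSum.of (Cochain F G) (1 + 1))

theorem d_oneElt (f : C(G, F)) :
    (cochainDGA F G).d (oneElt f) = twoElt (coboundary 1 (oneCochain f)) :=
  cochainD_of _

theorem oneElt_mul (f f' : C(G, F)) :
    oneElt f * oneElt f' = twoElt (cup (oneCochain f) (oneCochain f')) :=
  DirectSum.of_mul_of _ _

theorem oneElt_mem (f : C(G, F)) : oneElt f ∈ (cochainDGA F G).gr 1 :=
  of_mem_cochainGr (n := 1) (oneCochain f)

theorem exists_eq_oneElt {a : (cochainDGA F G).carrier} (ha : a ∈ (cochainDGA F G).gr 1) :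
    ∃ f : C(G, F), a = oneElt f := by
  rcases exists_of_mem_cochainGr ha with rfl | ⟨n, φ, hn, rfl⟩
  · exact ⟨0, (map_zero (DirectSum.of (Cochain F G) 1)).symm⟩
  · obtain rfl : n = 1 := by exact_mod_cast hn
    obtain ⟨f, rfl⟩ := exists_eq_oneCochain φ
    exact ⟨f, rfl⟩

/-- Turns identities in the cochain algebra into functional equations on `G`; additivity of
characters and both divided power laws are read off through it. -/
theorem d_oneElt_eq_iff (f : C(G, F)) (φ : Cochain F G (1 + 1)) :
    (cochainDGA F G).d (oneElt f) = twoElt φ ↔ ∀ g h, f h - f (g * h) + f g = φ ![g, h] := by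
  rw [d_oneElt, twoElt_injective.eq_iff]
  refine ⟨fun H g h => ?_, fun H => cochain_two_ext fun g h => ?_⟩
  · rw [← H, coboundary_one_apply]
  · rw [coboundary_one_apply, H]

theorem map_mul_of_d_oneElt_eq_zero {f : C(G, F)} (hf : (cochainDGA F G).d (oneElt f) = 0)
    (g h : G) : f (g * h) = f g + f h := by
  rw [← twoElt_zero, d_oneElt_eq_iff] at hf
  have := hf g h
  rw [ContinuousMap.zero_apply] at this
  linear_combination -this

/-- Cocycles of degree `1` anticommute up to coboundaries. -/
theorem exists_d_eq_mul_add_mul {a b : (cochainDGA F G).carrier}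
    (ha : a ∈ (cochainDGA F G).gr 1) (hb : b ∈ (cochainDGA F G).gr 1)
    (da : (cochainDGA F G).d a = 0) (db : (cochainDGA F G).d b = 0) :
    ∃ c, (cochainDGA F G).d c = a * b + b * a := by
  obtain ⟨f, rfl⟩ := exists_eq_oneElt ha
  obtain ⟨f', rfl⟩ := exists_eq_oneElt hb
  -- For additive `f` and `f'`, the pointwise product at `g * h` has the cross terms `f g * f' h + f
  -- h * f' g`. The coboundary takes the value at `g * h` with a minus sign, hence the minus here.
  refine ⟨oneElt (-(f * f')), ?_⟩
  rw [oneElt_mul, oneElt_mul, ← twoElt_add, d_oneElt_eq_iff]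
  intro g h
  rw [ContinuousMap.add_apply, cup_oneCochain_apply, cup_oneCochain_apply]
  simp only [ContinuousMap.neg_apply, ContinuousMap.mul_apply]
  rw [map_mul_of_d_oneElt_eq_zero da, map_mul_of_d_oneElt_eq_zero db]
  ring

/-- There are no nonzero coboundaries of degree `1`. -/
theorem eq_zero_of_d_mem_gr_one {a c : (cochainDGA F G).carrier}
    (ha : a ∈ (cochainDGA F G).gr 1) (h : (cochainDGA F G).d c = a) : a = 0 := by
  -- `c` need not be homogeneous, but only its component of degree `0` contributes to degree `1` of
  -- `d c`; that component is a constant and has differential zero.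
  have e := (cochainDGA F G).d_proj 0 c
  rw [h, zero_add, GradedAlgebra.proj_apply, GradedAlgebra.proj_apply,
    DirectSum.decompose_of_mem_same _ ha] at e
  rw [← e]
  obtain ⟨r, hr⟩ := Submodule.mem_one.1 ((cochainDGA_isConnected F G).2.2.le
    (SetLike.coe_mem (DirectSum.decompose (cochainDGA F G).gr c 0)))
  rw [← hr]
  exact (cochainDGA F G).d_algebraMap r

/-- If a cocycle of degree `2` is a coboundary, it is the coboundary of a `1`-cochain. -/
theorem exists_d_oneElt_eq {φ : Cochain F G (1 + 1)} {c : (cochainDGA F G).carrier}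
    (h : (cochainDGA F G).d c = twoElt φ) :
    ∃ f : C(G, F), (cochainDGA F G).d (oneElt f) = twoElt φ := by
  have hm : twoElt φ ∈ (cochainDGA F G).gr (1 + 1) := of_mem_cochainGr (n := 1 + 1) φ
  -- As the right-hand side has degree `2`, `c` may be replaced by its component of degree `1`.
  have e := (cochainDGA F G).d_proj 1 c
  rw [h, GradedAlgebra.proj_apply, GradedAlgebra.proj_apply,
    DirectSum.decompose_of_mem_same _ hm] at e
  obtain ⟨f, hf⟩ := exists_eq_oneElt
    (SetLike.coe_mem (DirectSum.decompose (cochainDGA F G).gr c 1))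
  exact ⟨f, by rw [← hf, e]⟩

end OneCochains

/-! ### Divided powers of a character and units of `F[X] / (X ^ 4)` -/

section Unipotent

variable {F : Type*} [Field F] {G : Type*} [Group G]

/-- The quotient `F[X] / (X ^ 4)`. -/
abbrev TruncPoly (F : Type*) [Field F] : Type _ :=
  Polynomial F ⧸ Ideal.span {(Polynomial.X : Polynomial F) ^ 4}

/-- Functions behaving like divided powers of an additive character define a homomorphism to
`F[X] / (X ^ 4)`. -/
noncomputable def truncHom (χ c e : G → F) (hχ : ∀ g h, χ (g * h) = χ g + χ h)
    (hc : ∀ g h, c (g * h) = c g + c h + χ g * χ h)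
    (he : ∀ g h, e (g * h) = e g + e h + χ g * c h + c g * χ h) : G →* TruncPoly F :=
  letI q := Ideal.Quotient.mk (Ideal.span {(Polynomial.X : Polynomial F) ^ 4})
  { toFun := fun g => q (1 + Polynomial.C (χ g) * Polynomial.X +
      Polynomial.C (c g) * Polynomial.X ^ 2 + Polynomial.C (e g) * Polynomial.X ^ 3)
    map_one' := by
      have h1 : χ 1 = 0 := by simpa using hχ 1 1
      have h2 : c 1 = 0 := by simpa [h1] using hc 1 1
      have h3 : e 1 = 0 := by simpa [h1, h2] using he 1 1
      simp [h1, h2, h3]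
    map_mul' := fun g h => by
      rw [← map_mul, Ideal.Quotient.mk_eq_mk_iff_sub_mem, Ideal.mem_span_singleton]
      -- The three laws match all coefficients up to `X ^ 3`. The cofactor is minus the part of
      -- degree at least `4` of the product of the two cubic polynomials, divided by `X ^ 4`.
      refine ⟨-(Polynomial.C (χ g * e h + c g * c h + e g * χ h) +
        Polynomial.C (c g * e h + e g * c h) * Polynomial.X +
        Polynomial.C (e g * e h) * Polynomial.X ^ 2), ?_⟩
      rw [hχ, hc, he]
      simp only [map_add, map_mul]
      ring }

/-- By Frobenius, the cube of `1 + χ X + c X² + e X³` is `1 + χ³ X³ + c³ X⁶ + e³ X⁹`, and the term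
`χ³ X³` survives modulo `X ^ 4`. -/
theorem truncHom_pow_three_ne_one [CharP F 3] (χ c e : G → F)
    (hχ : ∀ g h, χ (g * h) = χ g + χ h) (hc : ∀ g h, c (g * h) = c g + c h + χ g * χ h)
    (he : ∀ g h, e (g * h) = e g + e h + χ g * c h + c g * χ h) {g : G} (hg : χ g ≠ 0) :
    truncHom χ c e hχ hc he g ^ 3 ≠ 1 := by
  intro h
  have h3 : (3 : Polynomial F) = 0 := by
    have := CharP.cast_eq_zero (Polynomial F) 3
    exact_mod_cast this
  change Ideal.Quotient.mk _ _ ^ 3 = 1 at h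
  rw [← map_pow, ← map_one (Ideal.Quotient.mk _), Ideal.Quotient.mk_eq_mk_iff_sub_mem,
    Ideal.mem_span_singleton, Polynomial.X_pow_dvd_iff] at h
  have h' := h 3 (by norm_num)
  rw [show (1 + Polynomial.C (χ g) * Polynomial.X + Polynomial.C (c g) * Polynomial.X ^ 2 +
      Polynomial.C (e g) * Polynomial.X ^ 3) ^ 3 - 1 =
      Polynomial.C (χ g ^ 3) * Polynomial.X ^ 3 + Polynomial.C (c g ^ 3) * Polynomial.X ^ 6 +
        Polynomial.C (e g ^ 3) * Polynomial.X ^ 9 by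
    have : Fact (Nat.Prime 3) := ⟨Nat.prime_three⟩
    rw [add_pow_char, add_pow_char, add_pow_char]
    simp only [map_pow]
    ring] at h'
  simp only [Polynomial.coeff_add, Polynomial.coeff_C_mul, Polynomial.coeff_X_pow] at h'
  exact hg (by simpa using h')

/-- Commutators die in an abelian group. This serves both to construct a character with values in
`ZMod 3` and to evaluate the relation in the units of `F[X] / (X ^ 4)`. -/
theorem map_demushkinWord_of_commGroup {H : Type*} [CommGroup H] (d : ℕ) (hd : 2 ≤ d) (q : ℕ)
    (f : FreeGroup (Fin d) →* H) :
    f (demushkinWord d hd q) = f (FreeGroup.of ⟨0, by omega⟩) ^ q := by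
  rw [demushkinWord, map_mul, map_pow, map_list_prod, List.map_ofFn, List.prod_ofFn]
  rw [Finset.prod_eq_one, mul_one]
  intro i _
  simp only [Function.comp_apply, comm, map_mul, map_inv]
  rw [mul_right_comm, mul_right_comm _ _ (f (FreeGroup.of _))]
  simp [mul_comm]

/-- A group in which the word `x₁ ^ 3 [x₁, x₂] ⋯` is trivial admits no divided powers of degree
`≤ 3` of an additive character that does not vanish on `x₁`. -/
theorem false_of_dividedPowers [CharP F 3] {d : ℕ} {hd : 2 ≤ d} {x : Fin d → G}
    (hx : FreeGroup.lift x (demushkinWord d hd 3) = 1) (χ c e : G → F)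
    (hχ : ∀ g h, χ (g * h) = χ g + χ h) (hc : ∀ g h, c (g * h) = c g + c h + χ g * χ h)
    (he : ∀ g h, e (g * h) = e g + e h + χ g * c h + c g * χ h) (h0 : χ (x ⟨0, by omega⟩) ≠ 0) :
    False := by
  refine truncHom_pow_three_ne_one χ c e hχ hc he h0 ?_
  -- A homomorphism from a group lands in the units, which form an abelian group because the
  -- quotient ring is commutative.
  have h := map_demushkinWord_of_commGroup (H := (TruncPoly F)ˣ) d hd 3
    ((truncHom χ c e hχ hc he).toHomUnits.comp (FreeGroup.lift x))
  rw [MonoidHom.comp_apply, hx, map_one, MonoidHom.comp_apply, FreeGroup.lift_apply_of] at h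
  exact (congrArg Units.val h).symm

end Unipotent

/-! ### The restricted Massey product in characteristic `3` -/

section Bockstein

variable {F : Type*} [Field F] [TopologicalSpace F] [DiscreteTopology F] [CharP F 3]
  {G : Type*} [Group G] [TopologicalSpace G] [IsTopologicalGroup G]

/-- In characteristic `3` the square of a cocycle of degree `1` is a coboundary. -/
theorem exists_d_eq_mul_self {a : (cochainDGA F G).carrier} (ha : a ∈ (cochainDGA F G).gr 1)
    (da : (cochainDGA F G).d a = 0) : ∃ c, (cochainDGA F G).d c = a * a := by
  obtain ⟨c, hc⟩ := exists_d_eq_mul_add_mul ha ha da da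
  -- Anticommutativity of `a` with itself gives `d c = 2 a a`, and `-2 = 1` in characteristic `3`.
  refine ⟨-c, ?_⟩
  have h3 : (3 : F) = 0 := by exact_mod_cast CharP.cast_eq_zero F 3
  have h : (3 : F) • (a * a) = 0 := by rw [h3, zero_smul]
  rw [map_neg, hc, neg_eq_iff_add_eq_zero, ← h]
  module

/-- The triple Massey product of a character `χ` with itself, for the canonical indeterminacy, does
not vanish if `χ` does not vanish on `x₁`. -/
theorem not_exists_d_eq_massey {d : ℕ} {hd : 2 ≤ d} {x : Fin d → G}
    (hx : FreeGroup.lift x (demushkinWord d hd 3) = 1) {χ : C(G, F)}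
    (hχ : (cochainDGA F G).d (oneElt χ) = 0) (h0 : χ (x ⟨0, by omega⟩) ≠ 0)
    {b : (cochainDGA F G).carrier} (hb : b ∈ (cochainDGA F G).gr 1)
    (db : (cochainDGA F G).d b = -(oneElt χ * oneElt χ)) :
    ¬ ∃ c, (cochainDGA F G).d c = oneElt χ * b + b * oneElt χ := by
  rintro ⟨c, hc⟩
  obtain ⟨b, rfl⟩ := exists_eq_oneElt hb
  rw [oneElt_mul, oneElt_mul, ← twoElt_add] at hc
  obtain ⟨e, he⟩ := exists_d_oneElt_eq hc
  rw [d_oneElt_eq_iff] at he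
  rw [oneElt_mul, ← twoElt_neg, d_oneElt_eq_iff] at db
  -- The coboundary of a function `f` is `f h - f (g * h) + f g`. So `d b = -χ χ` makes `b` itself
  -- the second divided power, whereas `d e = χ b + b χ` has the opposite sign and the third one is
  -- `-e`.
  refine false_of_dividedPowers hx χ b (-e) (map_mul_of_d_oneElt_eq_zero hχ) (fun g h => ?_)
    (fun g h => ?_) h0
  · have := db g h
    rw [ContinuousMap.neg_apply, cup_oneCochain_apply] at this
    linear_combination -this
  · have := he g h
    rw [ContinuousMap.add_apply, cup_oneCochain_apply, cup_oneCochain_apply] at this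
    simp only [Pi.neg_apply]
    linear_combination this

end Bockstein

/-! ### Vanishing canonical class or `A₃`-formality kills the Massey product -/

namespace DGAlgebra

variable {F : Type*} [Field F] {A : DGAlgebra F}

/-- If the canonical class vanishes, then for every cocycle `a` of degree `1` whose square is a
coboundary and which anticommutes up to coboundaries with the cocycles of degree `1`, some triple
Massey product `⟨a, a, a⟩` formed with a single bounding cochain vanishes. -/
theorem exists_d_eq_massey_of_canonicalClass_eq_zero (h : A.canonicalClass = 0)
    (h1 : ∀ a c, a ∈ A.gr 1 → A.d c = a → a = 0) {a : A.carrier} (ha : a ∈ A.gr 1)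
    (da : A.d a = 0) (haa : ∃ c, A.d c = a * a)
    (hcomm : ∀ b ∈ A.gr 1, A.d b = 0 → ∃ c, A.d c = a * b + b * a) :
    ∃ b ∈ A.gr 1, A.d b = -(a * a) ∧ ∃ c, A.d c = a * b + b * a := by
  obtain ⟨L⟩ : Nonempty A.LiftPair := inferInstance
  rw [canonicalClass_eq L, LiftPair.hochschildClass, Submodule.Quotient.mk_eq_zero] at h
  obtain ⟨η, hη, e⟩ := h
  replace e : hochschildDifferential A.cohomologyGr (-1) 2 η = L.m₃ := e
  set X : A.Cohomology := A.cls ⟨a, da⟩ with hX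
  have hXm : X ∈ A.cohomologyGr 1 := ⟨⟨a, da⟩, ha, rfl⟩
  have hXX : X * X = 0 := by
    rw [hX, ← cls_mul, cls_eq_zero]
    exact haa
  -- Two representatives of a class of degree `1` differ by a coboundary of degree `1`, hence not at
  -- all; so `L.f₁` picks `a` itself.
  have hf : (L.f₁ X : A.carrier) = a := by
    have h0 : A.cls (L.f₁ X - ⟨a, da⟩) = 0 := by rw [map_sub, L.cls_f₁, ← hX, sub_self]
    obtain ⟨c, hc⟩ := A.cls_eq_zero.1 h0
    exact sub_eq_zero.1 (h1 _ c (sub_mem (L.f₁_mem 1 X hXm) ha) hc)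
  refine ⟨L.f₂ X X, L.f₂_mem 1 1 X X hXm hXm, ?_, ?_⟩
  · rw [L.d_f₂, hXX, hf]
    simp
  -- The degree is `1 + 1 - 1 = 1`, so anticommutativity with `a` applies to a representative of `η
  -- ![X, X]`.
  have hηm : η ![X, X] ∈ A.cohomologyGr 1 := by
    have := hη ![1, 1] ![X, X] (fun t => by fin_cases t <;> exact hXm)
    simpa using this
  obtain ⟨z, hz, hzη⟩ := hηm
  replace hz : (z : A.carrier) ∈ A.gr 1 := hz
  -- At this triple the inner terms of the Hochschild differential vanish since `X * X = 0`, and the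
  -- sign of the first term is `-1` since `X` has degree `1`. What is left is `-(X * η ![X, X] + η
  -- ![X, X] * X)`.
  have hm := congrArg (fun f => f ![X, X, X]) e
  simp only [hochschildDifferential_two, hXX, L.m₃val_eq] at hm
  rw [signTwist_of_mem A.cohomologyGr (-1) hXm, η.map_coord_zero (m := ![0, X]) 0 rfl,
    η.map_coord_zero (m := ![X, 0]) 1 rfl, ← hzη] at hm
  obtain ⟨c, hc⟩ := hcomm z hz z.2
  have hzX : X * A.cls z + A.cls z * X = 0 := by
    rw [hX, ← cls_mul, ← cls_mul, ← map_add, cls_eq_zero]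
    exact ⟨c, hc⟩
  have hΦ : A.cls ⟨L.Φ₃ X X X, L.d_Φ₃ X X X⟩ = 0 := by
    rw [← hm, ← neg_eq_zero, ← hzX]
    simp
    abel
  obtain ⟨w, hw⟩ := A.cls_eq_zero.1 hΦ
  replace hw : A.d w = L.Φ₃ X X X := hw
  -- With `b = L.f₂ X X` and `X * X = 0`, the cocycle `L.Φ₃ X X X` is `-(a * b + b * a)`.
  refine ⟨-w, ?_⟩
  rw [map_neg, hw, LiftPair.Φ₃, hXX, hf, A.inv_of_mem ha]
  simp
  abel

/-- If `A` is `A₃`-formal, then for every cocycle `a` of degree `1` whose square is a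
coboundary, some triple Massey product `⟨a, a, a⟩` formed with a single bounding cochain
vanishes. -/
theorem exists_d_eq_massey_of_isA3Formal (hA : A.IsConnected) (h : A.IsA3Formal hA)
    (h1 : ∀ a c, a ∈ A.gr 1 → A.d c = a → a = 0) {a : A.carrier} (ha : a ∈ A.gr 1)
    (da : A.d a = 0) (haa : ∃ c, A.d c = a * a) :
    ∃ b ∈ A.gr 1, A.d b = -(a * a) ∧ ∃ c, A.d c = a * b + b * a := by
  obtain ⟨M, f, hmin, ⟨hinj, hsurj⟩, hm₃⟩ := h
  have hm₁ : ∀ y, M.m₁ y = 0 := fun y => by rw [hmin]; rfl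
  have hker : ∀ y, y ∈ LinearMap.ker M.m₁ := hm₁
  -- The morphism `f` is restated with values in `A.carrier` itself, with `m₁ = 0` and `m₃ = 0` on
  -- `M` and the sign of a degree `1` element inserted. As `M` is minimal it is its own cohomology,
  -- so injectivity says that `k₁ y` is a coboundary only for `y = 0`.
  obtain ⟨k₁, k₂, k₃, hk₁, hk₂, inj, surj, h2, h3⟩ : ∃ (k₁ : M.carrier →ₗ[F] A.carrier)
      (k₂ : M.carrier →ₗ[F] M.carrier →ₗ[F] A.carrier)
      (k₃ : M.carrier →ₗ[F] M.carrier →ₗ[F] M.carrier →ₗ[F] A.carrier),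
      (∀ i, ∀ y ∈ M.gr i, k₁ y ∈ A.gr i) ∧
      (∀ i j y z, y ∈ M.gr i → z ∈ M.gr j → k₂ y z ∈ A.gr (i + j - 1)) ∧
      (∀ y, (∃ c, A.d c = k₁ y) → y = 0) ∧
      (∃ y c, A.d c = k₁ y - a) ∧
      (∀ y ∈ M.gr 1, k₁ (M.m₂ y y) - k₁ y * k₁ y = A.d (k₂ y y)) ∧
      ∀ y ∈ M.gr 1, A.d (k₃ y y y) + (-(k₁ y * k₂ y y) - k₂ y y * k₁ y) =
        k₂ (M.m₂ y y) y - k₂ y (M.m₂ y y) := by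
    refine ⟨f.f₁, f.f₂, f.f₃, f.f₁_mem, f.f₂_mem, ?_, ?_, ?_, ?_⟩
    · rintro y ⟨c, hc⟩
      have h0 : f.cohomologyMap (Submodule.Quotient.mk ⟨y, hker y⟩) = f.cohomologyMap 0 := by
        rw [map_zero]
        exact (Submodule.Quotient.mk_eq_zero _).2 ⟨c, hc⟩
      obtain ⟨y', hy'⟩ := (Submodule.Quotient.mk_eq_zero _).1 (hinj h0)
      rw [hm₁] at hy'
      exact hy'.symm
    · obtain ⟨q, hq⟩ := hsurj (Submodule.Quotient.mk ⟨a, da⟩)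
      obtain ⟨⟨y, hy⟩, rfl⟩ := Submodule.Quotient.mk_surjective _ q
      obtain ⟨c, hc⟩ := (Submodule.Quotient.eq _).1 hq
      exact ⟨y, c, hc⟩
    · intro y hy
      have := f.map_m₂ 1 y y hy
      simp only [hm₁, map_zero, LinearMap.zero_apply, smul_zero, add_zero] at this
      exact this
    · intro y hy
      have := f.map_m₃ 1 1 y y y hy hy
      simp only [hm₁, hm₃, map_zero, LinearMap.zero_apply, smul_zero, add_zero, zero_add,
        zpow_one, neg_one_smul] at this
      refine Eq.trans ?_ this
      exact (add_zero _).symm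
  -- Surjectivity on cohomology gives a possibly inhomogeneous `y` with `k₁ y - a` a coboundary.
  -- Projecting to degree `1` leaves a coboundary of degree `1`, which is zero.
  obtain ⟨y, hy, hya⟩ : ∃ y ∈ M.gr 1, k₁ y = a := by
    obtain ⟨y, c, hc⟩ := surj
    have hproj : ∀ y : M.carrier, k₁ (DirectSum.decompose M.gr y 1 : M.carrier) =
        GradedAlgebra.proj A.gr 1 (k₁ y) := by
      intro y
      induction y using DirectSum.Decomposition.inductionOn M.gr with
      | zero => simp
      | @homogeneous i m =>
        have hmem : k₁ m ∈ A.gr i := hk₁ i m m.2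
        rw [GradedAlgebra.proj_apply]
        by_cases hi : i = 1
        · subst hi
          rw [DirectSum.decompose_of_mem_same _ m.2, DirectSum.decompose_of_mem_same _ hmem]
        · rw [DirectSum.decompose_of_mem_ne _ m.2 hi, DirectSum.decompose_of_mem_ne _ hmem hi,
            map_zero]
      | add m m' hm hm' =>
        rw [DirectSum.decompose_add, DirectSum.add_apply, Submodule.coe_add, map_add, hm, hm',
          map_add, map_add]
    refine ⟨_, SetLike.coe_mem (DirectSum.decompose M.gr y 1), ?_⟩
    have hp : GradedAlgebra.proj A.gr 1 (A.d c) = GradedAlgebra.proj A.gr 1 (k₁ y) - a := by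
      rw [hc, map_sub, GradedAlgebra.proj_apply A.gr 1 a, DirectSum.decompose_of_mem_same _ ha]
    rw [hproj, ← sub_eq_zero, ← hp]
    refine h1 _ (GradedAlgebra.proj A.gr 0 c) ?_ (A.d_proj 0 c)
    rw [GradedAlgebra.proj_apply]
    exact SetLike.coe_mem _
  -- `k₁ (M.m₂ y y)` equals `a * a + A.d (k₂ y y)`, a coboundary, so injectivity applies.
  have hyy : M.m₂ y y = 0 := by
    obtain ⟨c, hc⟩ := haa
    refine inj _ ⟨k₂ y y + c, ?_⟩
    rw [map_add, ← h2 y hy, hc, hya, sub_add_cancel]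
  refine ⟨k₂ y y, hk₂ 1 1 y y hy hy, ?_, k₃ y y y, ?_⟩
  · rw [← h2 y hy, hyy, hya, map_zero, zero_sub]
  · have h4 := h3 y hy
    -- Both terms on the right contain `M.m₂ y y = 0`, so the identity reads `A.d (k₃ y y y) = a * b
    -- + b * a` for `b = k₂ y y`. No Hochschild cochain intervenes, so anticommutativity is not
    -- needed here.
    rw [hyy, hya, map_zero, map_zero, LinearMap.zero_apply, sub_zero] at h4
    rw [← sub_eq_zero, ← h4]
    abel

end DGAlgebra

/-! ### The character, and the conclusion -/

/-- The character of a pro-`3` group with relation `x₁ ^ 3 [x₁, x₂] ⋯` that maps all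
generators to `1`. -/
theorem exists_character {d : ℕ} {hd : 2 ≤ d} {G : Type*} [Group G] [TopologicalSpace G]
    [IsTopologicalGroup G] {x : Fin d → G} (hG : IsProPPresentation 3 (demushkinWord d hd 3) x) :
    ∃ χ : C(G, ZMod 3), (cochainDGA (ZMod 3) G).d (oneElt χ) = 0 ∧ ∀ i, χ (x i) = 1 := by
  -- The constant family `1` satisfies the relation in `ZMod 3`: the commutators vanish and `3 • 1 =
  -- 0`.
  obtain ⟨φ, hφ⟩ := hG.exists_hom (Multiplicative (ZMod 3))
    (IsPGroup.of_card (n := 1) (by simp)) (fun _ => Multiplicative.ofAdd 1) (by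
      rw [map_demushkinWord_of_commGroup, FreeGroup.lift_apply_of]
      decide)
  refine ⟨⟨fun g => (φ g).toAdd, continuous_toAdd.comp φ.continuous⟩, ?_, fun i => ?_⟩
  · rw [← twoElt_zero, d_oneElt_eq_iff]
    intro g h
    simp
  · simp [hφ]

end A3F

theorem theorem5p13 (d : ℕ) (hd : 2 ≤ d) (hd_even : Even d) {G : Type*} [Group G]
    [TopologicalSpace G] [IsTopologicalGroup G] (x : Fin d → G)
    (hG : A3F.IsProPPresentation 3 (A3F.demushkinWord d hd 3) x) :
    (A3F.cochainDGA (ZMod 3) G).canonicalClass ≠ 0 ∧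
      ¬ (A3F.cochainDGA (ZMod 3) G).IsA3Formal (A3F.cochainDGA_isConnected (ZMod 3) G) := by
  obtain ⟨χ, dχ, hχ⟩ := A3F.exists_character hG
  have h0 : χ (x ⟨0, by omega⟩) ≠ 0 := by rw [hχ]; decide
  -- Either property would produce such a `b`; the value `χ (x₁) = 1 ≠ 0` excludes it.
  have key : ¬ ∃ b ∈ (A3F.cochainDGA (ZMod 3) G).gr 1, (A3F.cochainDGA (ZMod 3) G).d b =
      -(A3F.oneElt χ * A3F.oneElt χ) ∧ ∃ c, (A3F.cochainDGA (ZMod 3) G).d c =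
        A3F.oneElt χ * b + b * A3F.oneElt χ := by
    rintro ⟨b, hb, db, hc⟩
    exact A3F.not_exists_d_eq_massey hG.relation dχ h0 hb db hc
  have h1 : ∀ a c, a ∈ (A3F.cochainDGA (ZMod 3) G).gr 1 →
      (A3F.cochainDGA (ZMod 3) G).d c = a → a = 0 := fun _ _ => A3F.eq_zero_of_d_mem_gr_one
  have hm := A3F.oneElt_mem χ
  have hsq := A3F.exists_d_eq_mul_self hm dχ
  exact ⟨fun h => key (A3F.DGAlgebra.exists_d_eq_massey_of_canonicalClass_eq_zero h h1 hm dχ hsq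
      fun _ hb db => A3F.exists_d_eq_mul_add_mul hm hb dχ db),
    fun h => key (A3F.DGAlgebra.exists_d_eq_massey_of_isA3Formal _ h h1 hm dχ hsq)⟩
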